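/- Let $m\ge 1$ and let $\mathbb{R}_{0,m}$ be the real Clifford algebra generated by $e_1,\dots,e_m$ with $e_j^2=-1$ and $e_je_k=-e_ke_j$ for $j\ne k$; identify $(x_0,x_1,\dots,x_m)\in\mathbb{R}^{m+1}$ with $x_0+\underline{x}$, where $\underline{x}=\sum_{j=1}^m x_je_j$. Let $R\subset\mathbb{R}^m\setminus\{0\}$ be a (reduced, finite) root system with reflections $\sigma_\alpha$, $\alpha\in R$, and positive subsystem $R_+$, and let $\kappa:R\to\mathbb{R}$ be a multiplicity function, i.e. a function invariant under the reflection group generated by the $\sigma_\alpha$. The Dunkl operators are $$T_jg(\underline{y})=\partial_{y_j}g(\underline{y})+\sum_{\alpha\in R_+}\kappa(\alpha)\,\frac{g(\underline{y})-g(\sigma_\alpha \underline{y})}{\langle\alpha,\underline{y}\rangle}\,\alpha_j ,\qquad j=1,\dots,m,$$ where the quotient is extended by continuity to the hyperplane $\langle\alpha,\underline{y}\rangle=0$. Assume that $\gamma_\kappa:=\sum_{\alpha\in R_+}\kappa(\alpha)=(1-m)/2$ and that $\kappa\notin K^{\rm sing}$, i.e. that the bilinear form $[p,q]_\kappa=(p(T)q)(0)$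 on real polynomials is non-degenerate. Let $D\subset\mathbb{C}$ be open and symmetric with respect to the real axis, and let $f$ be slice regular on $\Omega_D=\{a+\underline{\omega}b: a+ib\in D,\ \underline{\omega}\in\mathbb{R}^m,\ |\underline{\omega}|=1\}$, i.e. $f(a+\underline{\omega}b)=\alpha(a+ib)+\underline{\omega}\,\beta(a+ib)$ for functions $\alpha,\beta:D\to\mathbb{R}_{0,m}$ with $\alpha(\bar z)=\alpha(z)$, $\beta(\bar z)=-\beta(z)$ and $\alpha+i\beta:D\to\mathbb{R}_{0,m}\otimes\mathbb{C}$ holomorphic. Put $$\mathcal{T}f(x_0+\underline{x})={\rm Exp}\Big(\sum_{j=1}^m x_jT_j^{(\underline{y})}\Big)f(x_0+\underline{y})\Big|_{\underline{y}=0}=\sum_{n=0}^\infty\frac1{n!}\Big(\sum_{j=1}^m x_jT_j^{(\underline{y})}\Big)^nf(x_0+\underline{y})\Big|_{\underline{y}=0},\qquad x_0\in D\cap\mathbb{R}.$$ Then this series converges absolutely and locally uniformly on some open neighbourhood, in $\{x_0+\underline{x}: x_0\in D\cap\mathbb{R}\}$, of the set $D\cap\mathbb{R}$ of real points of $\Omega_D$;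 and on every open subset of $\{x_0+\underline{x}: x_0\in D\cap\mathbb{R}\}$ on which it converges locally uniformly, $\mathcal{T}f$ is monogenic, that is, of class $\mathcal{C}^1$ with $$\Big(\partial_{x_0}+\sum_{j=1}^m e_j\partial_{x_j}\Big)\mathcal{T}f=0 .$$ -/

import Mathlib

open scoped ComplexConjugate Topology

noncomputable section

namespace DunklSlice

/-! ### Clifford algebra -/

/-- The space `ℝᵐ` with its Euclidean inner product. -/
abbrev Vec (m : ℕ) : Type := EuclideanSpace ℝ (Fin m)

/-- The negative definite quadratic form `v ↦ -|v|²`. -/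
def negForm (m : ℕ) : QuadraticForm ℝ (Vec m) :=
  -LinearMap.BilinMap.toQuadraticMap (innerₗ (Vec m))

/-- The real Clifford algebra `ℝ_{0,m}`: `v² = -|v|²` for every vector `v`. -/
abbrev Cl (m : ℕ) : Type := CliffordAlgebra (negForm m)

/-- The embedding of vectors `x = ∑ xⱼ eⱼ` into the Clifford algebra. -/
def vec {m : ℕ} (v : Vec m) : Cl m := CliffordAlgebra.ι (negForm m) v

/-- The standard basis vector `eⱼ` of `ℝᵐ`. -/
def stdVec {m : ℕ} (j : Fin m) : Vec m := EuclideanSpace.single j 1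

/-- The generators `e₁, …, eₘ` of the Clifford algebra. -/
def e {m : ℕ} (j : Fin m) : Cl m := vec (stdVec j)

theorem finite_exteriorAlgebra (m : ℕ) :
    Module.Finite ℝ (ExteriorAlgebra ℝ (Vec m)) := by
  have hz : ∀ n, m < n → (⋀[ℝ]^n (Vec m)) = ⊥ := by
    intro n hn
    have h : Module.finrank ℝ (⋀[ℝ]^n (Vec m)) = 0 := by
      rw [exteriorPower.finrank_eq, finrank_euclideanSpace_fin, Nat.choose_eq_zero_of_lt hn]
    exact Submodule.finrank_eq_zero.1 h
  have htop : (⨆ n : ℕ, (⋀[ℝ]^n (Vec m))) = ⊤ :=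
    (DirectSum.Decomposition.isInternal
      (fun n : ℕ => (⋀[ℝ]^n (Vec m)))).submodule_iSup_eq_top
  have hle : (⊤ : Submodule ℝ (ExteriorAlgebra ℝ (Vec m))) ≤
      ⨆ i : Fin (m + 1), (⋀[ℝ]^(i : ℕ) (Vec m)) := by
    rw [← htop]
    refine iSup_le fun n => ?_
    by_cases hn : m < n
    · rw [hz n hn]; exact bot_le
    · exact le_iSup (fun i : Fin (m + 1) => (⋀[ℝ]^(i : ℕ) (Vec m))) ⟨n, by omega⟩
  refine ⟨?_⟩
  rw [← top_le_iff.1 hle]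
  exact Submodule.fg_iSup _ fun i => Module.Finite.iff_fg.1 inferInstance

instance finite_cl (m : ℕ) : Module.Finite ℝ (Cl m) :=
  haveI := finite_exteriorAlgebra m
  Module.Finite.equiv (CliffordAlgebra.equivExterior (negForm m)).symm

/-- A norm on the finite-dimensional space `ℝ_{0,m}` (the sup norm of the coordinates in some
basis). It only serves to speak of limits and derivatives, which do not depend on the choice. -/
instance normedAddCommGroup_cl (m : ℕ) : NormedAddCommGroup (Cl m) :=
  NormedAddCommGroup.induced (Cl m) (Fin (Module.finrank ℝ (Cl m)) → ℝ)
    (Module.finBasis ℝ (Cl m)).equivFun (Module.finBasis ℝ (Cl m)).equivFun.injective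

instance normedSpace_cl (m : ℕ) : NormedSpace ℝ (Cl m) :=
  NormedSpace.induced ℝ (Cl m) (Fin (Module.finrank ℝ (Cl m)) → ℝ)
    (Module.finBasis ℝ (Cl m)).equivFun

/-! ### Root systems and Dunkl operators -/

/-- The reflection `σ_α x = x - 2 ⟨α, x⟩ / |α|² α` in the hyperplane orthogonal to `α`. -/
def rootRefl {m : ℕ} (α : Vec m) : Vec m ≃ₗᵢ[ℝ] Vec m := (Submodule.span ℝ {α})ᗮ.reflection

theorem rootRefl_apply {m : ℕ} (α x : Vec m) :
    rootRefl α x = x - (2 * (inner ℝ α x / ‖α‖ ^ 2)) • α := by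
  rw [rootRefl, Submodule.reflection_orthogonal_apply, Submodule.reflection_singleton_apply]
  simp only [neg_sub, RCLike.ofReal_real_eq_id, id, two_mul, add_smul]
  module

/-- A (reduced, not necessarily crystallographic) root system in `ℝᵐ`. -/
structure IsRootSystem {m : ℕ} (R : Finset (Vec m)) : Prop where
  zero_notMem : (0 : Vec m) ∉ R
  inter_line : ∀ α ∈ R, (R : Set (Vec m)) ∩ (Submodule.span ℝ {α} : Set (Vec m)) = {α, -α}
  refl_image : ∀ α ∈ R, rootRefl α '' (R : Set (Vec m)) = R

/-- `Rp` is a positive subsystem of `R`: the roots on one side of a hyperplane through the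
origin that contains no root. -/
def IsPositiveSubsystem {m : ℕ} (R Rp : Finset (Vec m)) : Prop :=
  ∃ v : Vec m, (∀ α ∈ R, inner ℝ α v ≠ 0) ∧ ∀ α, α ∈ Rp ↔ α ∈ R ∧ 0 < inner ℝ α v

/-- The reflection group generated by the reflections `σ_α`, `α ∈ R`. -/
def coxeterGroup {m : ℕ} (R : Finset (Vec m)) : Subgroup (Vec m ≃ₗᵢ[ℝ] Vec m) :=
  Subgroup.closure {w | ∃ α ∈ R, w = rootRefl α}

/-- Multiplicity functions: invariant under the reflection group. Only the values of `κ` on `R`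
matter. -/
def IsMultiplicity {m : ℕ} (R : Finset (Vec m)) (κ : Vec m → ℝ) : Prop :=
  ∀ w ∈ coxeterGroup R, ∀ α ∈ R, κ (w α) = κ α

/-- The index `γ_κ`, the sum of `κ` over the positive roots. -/
def index {m : ℕ} (Rp : Finset (Vec m)) (κ : Vec m → ℝ) : ℝ := ∑ α ∈ Rp, κ α

variable {m : ℕ} {V : Type*} [NormedAddCommGroup V] [NormedSpace ℝ V]

open Classical in
/-- The difference quotient `(g(y) - g(σ_α y)) / ⟨α, y⟩`. On the hyperplane `⟨α, y⟩ = 0` it is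
given its continuous extension `2 / |α|² ∂_α g(y)`. -/
def rho (α : Vec m) (g : Vec m → V) (y : Vec m) : V :=
  if inner ℝ α y = 0 then (2 / ‖α‖ ^ 2) • fderiv ℝ g y α
  else (inner ℝ α y)⁻¹ • (g y - g (rootRefl α y))

/-- The Dunkl operator `Tⱼ`. -/
def dunkl (Rp : Finset (Vec m)) (κ : Vec m → ℝ) (j : Fin m) (g : Vec m → V) (y : Vec m) : V :=
  fderiv ℝ g y (stdVec j) + ∑ α ∈ Rp, (κ α * α j) • rho α g y

/-- The operator `T₁^{s₁} ∘ ⋯ ∘ Tₘ^{sₘ}`. -/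
def dunklMonomial (Rp : Finset (Vec m)) (κ : Vec m → ℝ) (s : Fin m →₀ ℕ)
    (g : Vec m → V) : Vec m → V :=
  (List.finRange m).foldr (fun j h => (dunkl Rp κ j)^[s j] h) g

/-- The bilinear form `[p, q]_κ = (p(T) q)(0)` on polynomials. -/
def fischer (Rp : Finset (Vec m)) (κ : Vec m → ℝ) (p q : MvPolynomial (Fin m) ℝ) : ℝ :=
  ∑ s ∈ p.support,
    p.coeff s * dunklMonomial Rp κ s (fun y : Vec m => MvPolynomial.eval (fun i => y i) q) 0

/-- The singular set: the multiplicity functions for which `[·, ·]_κ` is degenerate. -/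
def singularSet (R Rp : Finset (Vec m)) : Set (Vec m → ℝ) :=
  {κ | IsMultiplicity R κ ∧ ∃ p, p ≠ 0 ∧ ∀ q, fischer Rp κ p q = 0}

/-! ### Slice regular and monogenic functions

A point `x₀ + x` of `ℝ^{m+1}` is the pair `(x₀, x) : ℝ × ℝᵐ`. -/

/-- `α + i β` is a holomorphic stem function on `D`, with values in `ℝ_{0,m} ⊗ ℂ` and holomorphic
for the complex structure given by multiplication by `i` (the Cauchy-Riemann equations). -/
structure IsHolomorphicStem (D : Set ℂ) (α β : ℂ → Cl m) : Prop where
  even : ∀ z ∈ D, α (conj z) = α z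
  odd : ∀ z ∈ D, β (conj z) = -β z
  differentiableAt_fst : ∀ z ∈ D, DifferentiableAt ℝ α z
  differentiableAt_snd : ∀ z ∈ D, DifferentiableAt ℝ β z
  cauchyRiemann_fst : ∀ z ∈ D, fderiv ℝ α z 1 = fderiv ℝ β z Complex.I
  cauchyRiemann_snd : ∀ z ∈ D, fderiv ℝ α z Complex.I = -fderiv ℝ β z 1

/-- `f` is slice regular on the circularization `Ω_D = {a + ω b : a + i b ∈ D, |ω| = 1}`: it is
induced there by a holomorphic stem function, `f (a + ω b) = α(a + ib) + ω β(a + ib)`. -/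
def IsSliceRegularOn (D : Set ℂ) (f : ℝ × Vec m → Cl m) : Prop :=
  ∃ α β : ℂ → Cl m, IsHolomorphicStem D α β ∧
    ∀ z ∈ D, ∀ ω : Vec m, ‖ω‖ = 1 → f (z.re, z.im • ω) = α z + vec ω * β z

/-- The generalized Cauchy-Riemann operator `∂_{x₀} + ∑ eⱼ ∂_{xⱼ}`. -/
def cauchyRiemann (F : ℝ × Vec m → Cl m) (x : ℝ × Vec m) : Cl m :=
  fderiv ℝ F x (1, 0) + ∑ j : Fin m, e j * fderiv ℝ F x (0, stdVec j)

/-- Classical (left) monogenic functions on an open set. -/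
def IsMonogenicOn (F : ℝ × Vec m → Cl m) (U : Set (ℝ × Vec m)) : Prop :=
  ContDiffOn ℝ 1 F U ∧ ∀ x ∈ U, cauchyRiemann F x = 0

/-! ### The inverse intertwining operator -/

/-- The operator `∑ⱼ xⱼ Tⱼ`, for fixed `x`. -/
def dunklDir (Rp : Finset (Vec m)) (κ : Vec m → ℝ) (x : Vec m) (g : Vec m → V) (y : Vec m) : V :=
  ∑ j : Fin m, x j • dunkl Rp κ j g y

/-- The `n`-th term `1/n! (∑ⱼ xⱼ Tⱼ^{(y)})ⁿ f(x₀ + y)` at `y = 0` of the exponential series. -/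
def expTerm (Rp : Finset (Vec m)) (κ : Vec m → ℝ) (f : ℝ × Vec m → V) (n : ℕ)
    (x : ℝ × Vec m) : V :=
  ((n.factorial : ℝ)⁻¹) • (dunklDir Rp κ x.2)^[n] (fun y => f (x.1, y)) 0

/-- Partial sums of the exponential series. -/
def expPartial (Rp : Finset (Vec m)) (κ : Vec m → ℝ) (f : ℝ × Vec m → V) (N : ℕ)
    (x : ℝ × Vec m) : V :=
  ∑ n ∈ Finset.range N, expTerm Rp κ f n x

/-- `T f(x₀ + x) = Exp(∑ⱼ xⱼ Tⱼ^{(y)}) f(x₀ + y)` at `y = 0`, the sum of the exponential series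
(meaningful where the series converges). -/
def invIntertwine (Rp : Finset (Vec m)) (κ : Vec m → ℝ) (f : ℝ × Vec m → V)
    (x : ℝ × Vec m) : V :=
  Filter.limUnder Filter.atTop fun N => expPartial Rp κ f N x

end DunklSlice

end

/-! Near a real point `t` a slice regular function is a power series `f (t, y) = ∑ vec y ^ n *
aₙ(t)` with `aₙ' = (n + 1) aₙ₊₁` (`IsHolomorphicStem.hasSum_taylorCoeff`,
`IsHolomorphicStem.hasDerivAt_taylorCoeff`). Each Dunkl operator lowers the degree by one, so at `y
= 0` the `n`-th power of the operator sees only the `n`-th term, and the `n`-th term of the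
exponential series is `Pₙ(x) aₙ(t)` with `Pₙ = dunklPow Rp κ n` (`IsHolomorphicStem.expTerm_eq`).

The condition on the index says that the Dunkl dimension `m + 2γ` equals `1`. The Dunkl-Dirac
operator therefore acts on powers of the vector variable as in one dimension, sending `vec y ^ n` to
`-n vec y ^ (n - 1)` (`dunklDirac_vec_pow`). Since Dunkl operators commute (`HomPoly.dunklAt_comm`),
the derivative of `Pₙ` in direction `v` moves one Dunkl operator inside, and the ordinary Dirac
operator sends `Pₙ` to `-n Pₙ₋₁` (`dirac_dunklPow`). Applied to `∑ Pₙ aₙ`, the Cauchy-Riemann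
operator thus produces a telescoping series (`cauchyRiemannL_eq_zero`).

Convergence near real points: an estimate on the coefficients of polynomials gives `‖Pₙ(x)‖ ≤ const
· (q‖x‖)ⁿ` (`norm_dunklPow_le`), which is set against Cauchy estimates for `aₙ`.

On an arbitrary open set of locally uniform convergence, the terms are eventually bounded by `1`
near each point. As `Pₙ` is homogeneous of degree `n`, comparing with a slightly dilated point
upgrades this to geometric decay (`eventually_norm_seriesTerm_le`). Markov's inequality bounds the
derivatives in `x` at the cost of a factor of order `n²` (`HomPoly.norm_fderiv_le_of_bound`), and
the derivative in `x₀` is itself a Dirac derivative of the next term (`norm_seriesTermDeriv_le`).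
The series can therefore be differentiated term by term. -/

noncomputable section

namespace DunklSlice

/-! ### Dunkl operators in arbitrary directions. -/

section DunklOperators

variable {m : ℕ} {V W : Type*} [NormedAddCommGroup V] [NormedSpace ℝ V]
  [NormedAddCommGroup W] [NormedSpace ℝ W]

/-- The Dunkl operator in the direction `a`, linear in `a`. -/
def dunklAt (Rp : Finset (Vec m)) (κ : Vec m → ℝ) (a : Vec m) (g : Vec m → V) (y : Vec m) : V :=
  fderiv ℝ g y a + ∑ α ∈ Rp, (κ α * inner ℝ α a) • rho α g y

theorem inner_stdVec (α : Vec m) (j : Fin m) : inner ℝ α (stdVec j) = α j := by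
  simp [stdVec, EuclideanSpace.inner_single_right]

theorem sum_smul_stdVec (x : Vec m) : ∑ j, x j • (stdVec j : Vec m) = x := by
  ext i
  simp [stdVec, Finset.sum_apply, Pi.single_apply]

theorem dunkl_eq_dunklAt (Rp : Finset (Vec m)) (κ : Vec m → ℝ) (j : Fin m) (g : Vec m → V) :
    dunkl Rp κ j g = dunklAt Rp κ (stdVec j) g := by
  ext y
  simp [dunkl, dunklAt, inner_stdVec]

theorem dunklAt_add_dir (Rp : Finset (Vec m)) (κ : Vec m → ℝ) (a b : Vec m) (g : Vec m → V) :
    dunklAt Rp κ (a + b) g = dunklAt Rp κ a g + dunklAt Rp κ b g := by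
  ext y
  simp only [dunklAt, map_add, inner_add_right, mul_add, add_smul, Finset.sum_add_distrib,
    Pi.add_apply]
  abel

theorem dunklAt_smul_dir (Rp : Finset (Vec m)) (κ : Vec m → ℝ) (c : ℝ) (a : Vec m)
    (g : Vec m → V) : dunklAt Rp κ (c • a) g = c • dunklAt Rp κ a g := by
  ext y
  simp only [dunklAt, map_smul, inner_smul_right, Pi.smul_apply, smul_add, Finset.smul_sum,
    smul_smul]
  congr 1
  refine Finset.sum_congr rfl fun α _ => ?_
  congr 1
  ring

theorem dunklAt_zero_dir (Rp : Finset (Vec m)) (κ : Vec m → ℝ) (g : Vec m → V) :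
    dunklAt Rp κ 0 g = 0 := by
  simpa using dunklAt_smul_dir Rp κ 0 0 g

theorem dunklAt_sum_dir {ι : Type*} (s : Finset ι) (Rp : Finset (Vec m)) (κ : Vec m → ℝ)
    (a : ι → Vec m) (g : Vec m → V) :
    dunklAt Rp κ (∑ i ∈ s, a i) g = ∑ i ∈ s, dunklAt Rp κ (a i) g := by
  classical
  induction s using Finset.induction_on with
  | empty => simp [dunklAt_zero_dir]
  | insert i s hi ih => rw [Finset.sum_insert hi, Finset.sum_insert hi, dunklAt_add_dir, ih]

theorem dunklDir_eq_dunklAt (Rp : Finset (Vec m)) (κ : Vec m → ℝ) (x : Vec m) :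
    (dunklDir Rp κ x : (Vec m → V) → Vec m → V) = dunklAt Rp κ x := by
  ext g y
  conv_rhs => rw [← sum_smul_stdVec x, dunklAt_sum_dir]
  simp [dunklDir, dunkl_eq_dunklAt, dunklAt_smul_dir]

theorem dunklAt_empty (κ : Vec m → ℝ) (a : Vec m) (g : Vec m → V) :
    dunklAt ∅ κ a g = fun y => fderiv ℝ g y a := by
  ext y; simp [dunklAt]

theorem rootRefl_of_inner_eq_zero {α y : Vec m} (h : inner ℝ α y = 0) : rootRefl α y = y := by
  simp [rootRefl_apply, h]

theorem inner_rootRefl_left (α x y : Vec m) :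
    inner ℝ (rootRefl α x) y = inner ℝ x (rootRefl α y) := by
  simp only [rootRefl_apply, inner_sub_left, inner_sub_right, inner_smul_left, inner_smul_right,
    real_inner_comm α x, conj_trivial]
  ring

theorem norm_rootRefl (α x : Vec m) : ‖rootRefl α x‖ = ‖x‖ := (rootRefl α).norm_map x

theorem rootRefl_map (w : Vec m ≃ₗᵢ[ℝ] Vec m) (α y : Vec m) :
    rootRefl (w α) (w y) = w (rootRefl α y) := by
  simp only [rootRefl_apply, w.inner_map_map, w.norm_map, map_sub, map_smul]

/-! ### Dunkl operators on differentiable functions -/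

theorem rho_add (α : Vec m) {g h : Vec m → V} {y : Vec m} (hg : DifferentiableAt ℝ g y)
    (hh : DifferentiableAt ℝ h y) : rho α (g + h) y = rho α g y + rho α h y := by
  unfold rho
  split_ifs
  · rw [fderiv_add hg hh]; simp
  · simp only [Pi.add_apply, ← smul_add]; congr 1; abel

theorem rho_clm_comp (α : Vec m) (L : V →L[ℝ] W) {g : Vec m → V} {y : Vec m}
    (hg : DifferentiableAt ℝ g y) : rho α (fun z => L (g z)) y = L (rho α g y) := by
  unfold rho
  split_ifs
  · have : fderiv ℝ (fun z => L (g z)) y = L.comp (fderiv ℝ g y) :=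
      (L.hasFDerivAt.comp y hg.hasFDerivAt).fderiv
    rw [this]
    simp
  · simp

theorem dunklAt_clm_comp (Rp : Finset (Vec m)) (κ : Vec m → ℝ) (a : Vec m) (L : V →L[ℝ] W)
    {g : Vec m → V} (hg : Differentiable ℝ g) :
    dunklAt Rp κ a (fun z => L (g z)) = fun y => L (dunklAt Rp κ a g y) := by
  ext y
  have : fderiv ℝ (fun z => L (g z)) y = L.comp (fderiv ℝ g y) :=
    (L.hasFDerivAt.comp y (hg y).hasFDerivAt).fderiv
  simp only [dunklAt, map_add, map_sum, map_smul, rho_clm_comp _ L (hg y), this,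
    ContinuousLinearMap.comp_apply]

theorem dunklAt_add (Rp : Finset (Vec m)) (κ : Vec m → ℝ) (a : Vec m) {g h : Vec m → V}
    (hg : Differentiable ℝ g) (hh : Differentiable ℝ h) :
    dunklAt Rp κ a (g + h) = dunklAt Rp κ a g + dunklAt Rp κ a h := by
  ext y
  simp only [dunklAt, rho_add _ (hg y) (hh y), smul_add, Finset.sum_add_distrib,
    fderiv_add (hg y) (hh y), Pi.add_apply, add_apply]
  abel

theorem dunklAt_smul (Rp : Finset (Vec m)) (κ : Vec m → ℝ) (a : Vec m) (c : ℝ) {g : Vec m → V}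
    (hg : Differentiable ℝ g) : dunklAt Rp κ a (c • g) = c • dunklAt Rp κ a g := by
  exact dunklAt_clm_comp Rp κ a (c • ContinuousLinearMap.id ℝ V) hg

theorem dunklAt_zero (Rp : Finset (Vec m)) (κ : Vec m → ℝ) (a : Vec m) :
    dunklAt Rp κ a (0 : Vec m → V) = 0 := by
  simpa using dunklAt_smul Rp κ a 0 (g := (0 : Vec m → V)) (differentiable_const _)

theorem dunklAt_const (Rp : Finset (Vec m)) (κ : Vec m → ℝ) (a : Vec m) (c : V) :
    dunklAt Rp κ a (fun _ => c) = 0 := by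
  ext y
  simp [dunklAt, rho]

theorem dunklAt_sum {ι : Type*} (s : Finset ι) (Rp : Finset (Vec m)) (κ : Vec m → ℝ)
    (a : Vec m) {g : ι → Vec m → V} (hg : ∀ i ∈ s, Differentiable ℝ (g i)) :
    dunklAt Rp κ a (∑ i ∈ s, g i) = ∑ i ∈ s, dunklAt Rp κ a (g i) := by
  classical
  induction s using Finset.induction_on with
  | empty => simp [dunklAt_zero]
  | insert i s hi ih =>
    rw [Finset.sum_insert hi, Finset.sum_insert hi, dunklAt_add, ih]
    · exact fun j hj => hg j (Finset.mem_insert_of_mem hj)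
    · exact hg i (Finset.mem_insert_self _ _)
    · exact Differentiable.sum fun j hj => hg j (Finset.mem_insert_of_mem hj)

theorem rho_inner_smul (α x : Vec m) {g : Vec m → V} {y : Vec m} (hg : DifferentiableAt ℝ g y) :
    rho α (fun z => inner ℝ x z • g z) y =
      inner ℝ x y • rho α g y + (2 * inner ℝ α x / ‖α‖ ^ 2) • g (rootRefl α y) := by
  unfold rho
  split_ifs with h
  · have h1 : HasFDerivAt (fun z : Vec m => inner ℝ x z) (innerSL ℝ x) y :=
      (innerSL ℝ x).hasFDerivAt
    have h2 : fderiv ℝ (fun z => inner ℝ x z • g z) y = _ := (h1.smul hg.hasFDerivAt).fderiv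
    rw [h2, rootRefl_of_inner_eq_zero h]
    simp [smul_smul, real_inner_comm α x]
    rw [mul_comm, mul_div_right_comm]
  · simp only [rootRefl_apply]
    rw [inner_sub_right, inner_smul_right]
    rw [real_inner_comm α x]
    match_scalars <;> field_simp
    ring

theorem inner_smul_rho (α : Vec m) (g : Vec m → V) (y : Vec m) :
    inner ℝ α y • rho α g y = g y - g (rootRefl α y) := by
  unfold rho
  split_ifs with h
  · simp [h, rootRefl_of_inner_eq_zero h]
  · rw [smul_inv_smul₀ h]

/-- The commutation relation between a Dunkl operator and multiplication by a linear form. -/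
theorem dunklAt_inner_smul (Rp : Finset (Vec m)) (κ : Vec m → ℝ) (a x : Vec m) {g : Vec m → V}
    (hg : Differentiable ℝ g) :
    dunklAt Rp κ a (fun z => inner ℝ x z • g z) = (fun y => inner ℝ x y • dunklAt Rp κ a g y) +
      inner ℝ x a • g +
      ∑ α ∈ Rp, (κ α * inner ℝ α a * (2 * inner ℝ α x / ‖α‖ ^ 2)) • (g ∘ rootRefl α) := by
  ext y
  have h1 : HasFDerivAt (fun z : Vec m => inner ℝ x z) (innerSL ℝ x) y :=
    (innerSL ℝ x).hasFDerivAt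
  have h2 : fderiv ℝ (fun z => inner ℝ x z • g z) y = _ := (h1.smul (hg y).hasFDerivAt).fderiv
  simp only [dunklAt, rho_inner_smul _ _ (hg y), smul_add, Finset.sum_add_distrib, h2, Pi.add_apply,
    Finset.sum_apply, Pi.smul_apply,
    Function.comp_apply, smul_smul, Finset.smul_sum]
  simp only [add_apply, smul_apply,
    ContinuousLinearMap.smulRight_apply, innerSL_apply_apply]
  simp_rw [mul_left_comm (inner ℝ x y), mul_assoc, mul_comm (inner ℝ x y)]
  abel

/-! ### Homogeneous polynomial maps with a bound on their coefficients -/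

/-- `HomPoly k B g`: the map `g` is a homogeneous polynomial of degree `k` that can be written as
a sum of terms `⟨a₁, y⟩ ⋯ ⟨aₖ, y⟩ c` in such a way that the sum of the `‖a₁‖ ⋯ ‖aₖ‖ ‖c‖` is at
most `B`. -/
inductive HomPoly : ℕ → ℝ → (Vec m → V) → Prop
  | const (c : V) : HomPoly 0 ‖c‖ (fun _ => c)
  | zero (k : ℕ) : HomPoly k 0 0
  | add {k : ℕ} {B C : ℝ} {g h : Vec m → V} :
      HomPoly k B g → HomPoly k C h → HomPoly k (B + C) (g + h)
  | mul {k : ℕ} {B : ℝ} {g : Vec m → V} (x : Vec m) :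
      HomPoly k B g → HomPoly (k + 1) (‖x‖ * B) (fun y => inner ℝ x y • g y)
  | mono {k : ℕ} {B C : ℝ} {g : Vec m → V} : B ≤ C → HomPoly k B g → HomPoly k C g

namespace HomPoly

variable {k : ℕ} {B C : ℝ} {g h : Vec m → V}

theorem nonneg (hg : HomPoly k B g) : 0 ≤ B := by
  induction hg with
  | const c => exact norm_nonneg _
  | zero k => exact le_rfl
  | add _ _ h1 h2 => exact add_nonneg h1 h2
  | mul x _ ih => exact mul_nonneg (norm_nonneg _) ih
  | mono h _ ih => exact ih.trans h

theorem contDiff (hg : HomPoly k B g) : ContDiff ℝ ⊤ g := by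
  induction hg with
  | const c => exact contDiff_const
  | zero k => exact contDiff_const
  | add _ _ h1 h2 => exact h1.add h2
  | mul x _ ih => exact (contDiff_const.inner ℝ contDiff_id).smul ih
  | mono h _ ih => exact ih

theorem differentiable (hg : HomPoly k B g) : Differentiable ℝ g :=
  hg.contDiff.differentiable (by simp)

theorem norm_le (hg : HomPoly k B g) (y : Vec m) : ‖g y‖ ≤ B * ‖y‖ ^ k := by
  induction hg with
  | const c => simp
  | zero k => simp
  | add _ _ h1 h2 =>
    rw [add_mul]
    exact (norm_add_le _ _).trans (add_le_add h1 h2)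
  | @mul k B g x hg ih =>
    rw [norm_smul, pow_succ, show ‖x‖ * B * (‖y‖ ^ k * ‖y‖) = (‖x‖ * ‖y‖) * (B * ‖y‖ ^ k) by ring]
    exact mul_le_mul (norm_inner_le_norm x y) ih (norm_nonneg _) (by positivity)
  | mono h _ ih => exact ih.trans (by gcongr)

theorem comp_rootRefl (hg : HomPoly k B g) (α : Vec m) : HomPoly k B (g ∘ rootRefl α) := by
  induction hg with
  | const c => exact .const c
  | zero k => exact .zero k
  | add _ _ h1 h2 => exact h1.add h2
  | mul x _ ih =>
    have := ih.mul (rootRefl α x)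
    rw [norm_rootRefl] at this
    simpa only [inner_rootRefl_left, Function.comp_def] using this
  | mono h _ ih => exact ih.mono h

theorem clm_comp (L : V →L[ℝ] W) (hg : HomPoly k B g) : HomPoly k (‖L‖ * B) (fun y => L (g y)) := by
  induction hg with
  | const c => exact (HomPoly.const (L c)).mono (L.le_opNorm c)
  | zero k => simpa [Pi.zero_def] using HomPoly.zero k
  | add _ _ h1 h2 => simpa [mul_add, Pi.add_def] using h1.add h2
  | @mul k B g x _ ih =>
    have := ih.mul x
    simpa [mul_left_comm] using this
  | mono h _ ih => exact ih.mono (by gcongr)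

theorem const_smul (c : ℝ) (hg : HomPoly k B g) : HomPoly k (|c| * B) (c • g) := by
  have := hg.clm_comp (c • ContinuousLinearMap.id ℝ V)
  refine HomPoly.mono ?_ this
  gcongr
  · exact hg.nonneg
  · rw [norm_smul, Real.norm_eq_abs]
    exact mul_le_of_le_one_right (abs_nonneg _) ContinuousLinearMap.norm_id_le

theorem sum {ι : Type*} {s : Finset ι} {b : ι → ℝ} {f : ι → Vec m → V}
    (hf : ∀ i ∈ s, HomPoly k (b i) (f i)) : HomPoly k (∑ i ∈ s, b i) (∑ i ∈ s, f i) := by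
  classical
  induction s using Finset.induction_on with
  | empty => simpa using HomPoly.zero k
  | insert i s hi ih =>
    rw [Finset.sum_insert hi, Finset.sum_insert hi]
    exact (hf i (Finset.mem_insert_self _ _)).add
      (ih fun j hj => hf j (Finset.mem_insert_of_mem hj))

theorem dunklAt_eq_zero (Rp : Finset (Vec m)) (κ : Vec m → ℝ) (a : Vec m) (hk : k = 0)
    (hg : HomPoly k B g) : dunklAt Rp κ a g = 0 := by
  induction hg with
  | const c => exact dunklAt_const _ _ _ _
  | zero k => exact dunklAt_zero _ _ _
  | add h1 h2 ih1 ih2 =>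
    rw [dunklAt_add _ _ _ h1.differentiable h2.differentiable, ih1 hk, ih2 hk, add_zero]
  | mul x _ ih => simp at hk
  | mono h _ ih => exact ih hk

end HomPoly

/-- The factor in the coefficient bound for Dunkl operators on homogeneous polynomials. -/
def dunklBound (Rp : Finset (Vec m)) (κ : Vec m → ℝ) : ℝ := 1 + ∑ α ∈ Rp, 2 * |κ α|

theorem dunklBound_pos (Rp : Finset (Vec m)) (κ : Vec m → ℝ) : 0 < dunklBound Rp κ :=
  add_pos_of_pos_of_nonneg one_pos (Finset.sum_nonneg fun _ _ => by positivity)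

theorem abs_reflection_coeff_le (c : ℝ) (α a x : Vec m) :
    |c * inner ℝ α a * (2 * inner ℝ α x / ‖α‖ ^ 2)| ≤ 2 * |c| * (‖x‖ * ‖a‖) := by
  rcases eq_or_ne α 0 with rfl | hα
  · simp; positivity
  · have h0 : 0 < ‖α‖ := norm_pos_iff.2 hα
    have h1 := abs_real_inner_le_norm α a
    have h2 := abs_real_inner_le_norm α x
    simp only [abs_mul, abs_div, abs_pow, abs_norm, Nat.abs_ofNat]
    calc |c| * |inner ℝ α a| * (2 * |inner ℝ α x| / ‖α‖ ^ 2)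
        ≤ |c| * (‖α‖ * ‖a‖) * (2 * (‖α‖ * ‖x‖) / ‖α‖ ^ 2) := by gcongr
      _ = 2 * |c| * (‖x‖ * ‖a‖) := by field_simp

/-- By the commutation relation, each linear factor contributes `⟨x, a⟩ g` and reflected copies of
`g`. Reflections are isometries and preserve the coefficient bound, so each factor costs the same
constant, whence the multiple `k`. Bounding coefficients rather than sup norms is what lets the
estimate be iterated. -/
theorem HomPoly.dunklAt (Rp : Finset (Vec m)) (κ : Vec m → ℝ) (a : Vec m) {k : ℕ} {B : ℝ}
    {g : Vec m → V} (hg : HomPoly k B g) :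
    HomPoly (k - 1) (k * (dunklBound Rp κ * ‖a‖ * B)) (dunklAt Rp κ a g) := by
  have hC := dunklBound_pos Rp κ
  induction hg with
  | const c => simpa [dunklAt_const] using HomPoly.zero 0
  | zero k => simpa [dunklAt_zero] using HomPoly.zero (k - 1)
  | add h1 h2 ih1 ih2 =>
    rw [dunklAt_add _ _ _ h1.differentiable h2.differentiable]
    exact (ih1.add ih2).mono (by ring_nf; exact le_rfl)
  | @mul k B g x hg ih =>
    rw [dunklAt_inner_smul _ _ _ _ hg.differentiable]
    have hB := hg.nonneg
    have h1 : HomPoly k (k * (dunklBound Rp κ * ‖a‖ * B) * ‖x‖)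
        (fun y => inner ℝ x y • DunklSlice.dunklAt Rp κ a g y) := by
      -- For `k = 0` the induction hypothesis times a linear form has degree `0 - 1 + 1 = 1`, not
      -- `0`; there the operator annihilates the constant instead.
      rcases k with _ | k
      · rw [hg.dunklAt_eq_zero Rp κ a rfl]
        simpa [Pi.zero_def] using HomPoly.zero 0
      · rw [mul_comm _ ‖x‖]
        exact ih.mul x
    have h2 : HomPoly k (‖x‖ * ‖a‖ * B) ((inner ℝ x a : ℝ) • g) :=
      (hg.const_smul _).mono (by gcongr; exact abs_real_inner_le_norm x a)
    have h3 : HomPoly k (∑ α ∈ Rp, 2 * |κ α| * (‖x‖ * ‖a‖) * B)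
        (∑ α ∈ Rp, (κ α * inner ℝ α a * (2 * inner ℝ α x / ‖α‖ ^ 2)) • (g ∘ rootRefl α)) :=
      HomPoly.sum fun α _ => ((hg.comp_rootRefl α).const_smul _).mono
        (by gcongr; exact abs_reflection_coeff_le _ _ _ _)
    refine ((h1.add h2).add h3).mono (le_of_eq ?_)
    rw [← Finset.sum_mul, ← Finset.sum_mul]
    have : ∑ α ∈ Rp, 2 * |κ α| = dunklBound Rp κ - 1 := by simp [dunklBound]
    rw [this]
    push_cast
    ring
  | mono h _ ih => exact ih.mono (by gcongr)

theorem HomPoly.iterate_dunklAt (Rp : Finset (Vec m)) (κ : Vec m → ℝ) (a : Vec m) (n : ℕ) {k : ℕ}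
    {B : ℝ} {g : Vec m → V} (hg : HomPoly k B g) :
    HomPoly (k - n) (k.descFactorial n * ((dunklBound Rp κ * ‖a‖) ^ n * B))
      ((DunklSlice.dunklAt Rp κ a)^[n] g) := by
  induction n with
  | zero => simpa using hg
  | succ n ih =>
    rw [Function.iterate_succ_apply']
    refine (ih.dunklAt Rp κ a).mono (le_of_eq ?_)
    rw [Nat.descFactorial_succ]
    push_cast
    ring

end DunklOperators

section Commutativity

variable {m : ℕ} {V W : Type*} [NormedAddCommGroup V] [NormedSpace ℝ V]
  [NormedAddCommGroup W] [NormedSpace ℝ W] {R Rp : Finset (Vec m)} {κ : Vec m → ℝ}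

/-! ### Equivariance under the reflection group and commutativity -/

theorem rootRefl_self (α : Vec m) : rootRefl α α = -α := by
  rcases eq_or_ne α 0 with rfl | hα
  · simp
  · have h0 : ‖α‖ ≠ 0 := norm_ne_zero_iff.2 hα
    rw [rootRefl_apply, real_inner_self_eq_norm_sq, div_self (pow_ne_zero 2 h0)]
    module

theorem rootRefl_neg (α y : Vec m) : rootRefl (-α) y = rootRefl α y := by
  simp [rootRefl_apply, neg_div, sub_eq_add_neg]

theorem rho_neg (α : Vec m) (g : Vec m → V) (y : Vec m) : rho (-α) g y = -rho α g y := by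
  unfold rho
  simp only [inner_neg_left, neg_eq_zero, rootRefl_neg, norm_neg, map_neg, inv_neg, neg_smul,
    smul_neg]
  split_ifs <;> rfl

theorem IsRootSystem.rootRefl_mem (hR : IsRootSystem R) {α β : Vec m} (hα : α ∈ R) (hβ : β ∈ R) :
    rootRefl α β ∈ R := by
  have : rootRefl α β ∈ rootRefl α '' (R : Set (Vec m)) := ⟨β, hβ, rfl⟩
  rwa [hR.refl_image α hα] at this

theorem IsRootSystem.neg_mem (hR : IsRootSystem R) {α : Vec m} (hα : α ∈ R) : -α ∈ R := by
  rw [← rootRefl_self]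
  exact hR.rootRefl_mem hα hα

theorem rootRefl_rootRefl (α y : Vec m) : rootRefl α (rootRefl α y) = y :=
  Submodule.reflection_reflection _ y

theorem IsMultiplicity.rootRefl (hκ : IsMultiplicity R κ) {α β : Vec m} (hα : α ∈ R)
    (hβ : β ∈ R) : κ (rootRefl α β) = κ β :=
  hκ _ (Subgroup.subset_closure ⟨α, hα, rfl⟩) β hβ

theorem IsPositiveSubsystem.sum_eq (hR : IsRootSystem R) (hRp : IsPositiveSubsystem R Rp)
    {F : Vec m → V} (hF : ∀ α ∈ R, F (-α) = F α) :
    ∑ α ∈ Rp, F α = (2 : ℝ)⁻¹ • ∑ α ∈ R, F α := by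
  classical
  obtain ⟨v, hv, hmem⟩ := hRp
  have h1 : Rp = R.filter (fun α => 0 < inner ℝ α v) := by
    ext α; simp [hmem]
  have h2 : ∑ α ∈ R.filter (fun α => ¬ 0 < inner ℝ α v), F α = ∑ α ∈ Rp, F α := by
    refine Finset.sum_nbij' (fun α => -α) (fun α => -α) ?_ ?_ (by simp) (by simp) ?_
    · intro α hα
      rw [Finset.mem_filter] at hα
      refine (hmem _).2 ⟨hR.neg_mem hα.1, ?_⟩
      rw [inner_neg_left]
      have := lt_of_le_of_ne (not_lt.1 hα.2) (hv α hα.1)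
      linarith
    · intro α hα
      rw [hmem] at hα
      refine Finset.mem_filter.2 ⟨hR.neg_mem hα.1, ?_⟩
      rw [inner_neg_left]
      linarith [hα.2]
    · intro α hα
      exact (hF α (Finset.mem_filter.1 hα).1).symm
  rw [← Finset.sum_filter_add_sum_filter_not R (fun α => 0 < inner ℝ α v), h2, ← h1, ← two_smul ℝ,
    smul_smul]
  norm_num

/-- Each summand is even in the root, being a product of two odd factors and the even `κ`. Unlike
`Rp`, the full root system is permuted by the reflections, which makes the equivariance below a
change of summation index. -/
theorem dunklAt_eq_sum_roots (hR : IsRootSystem R) (hRp : IsPositiveSubsystem R Rp)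
    (hκ : IsMultiplicity R κ) (a : Vec m) (g : Vec m → V) (y : Vec m) :
    dunklAt Rp κ a g y = fderiv ℝ g y a +
      (2 : ℝ)⁻¹ • ∑ α ∈ R, (κ α * inner ℝ α a) • rho α g y := by
  rw [dunklAt, IsPositiveSubsystem.sum_eq hR hRp]
  intro α hα
  have : κ (-α) = κ α := by rw [← rootRefl_self, hκ.rootRefl hα hα]
  simp [rho_neg, this]

theorem rho_comp_isometry (w : Vec m ≃ₗᵢ[ℝ] Vec m) (α : Vec m) {g : Vec m → V}
    (hg : Differentiable ℝ g) (y : Vec m) : rho α (g ∘ w) y = rho (w α) g (w y) := by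
  have h : fderiv ℝ (g ∘ w) y = (fderiv ℝ g (w y)).comp (w : Vec m →L[ℝ] Vec m) :=
    ((hg (w y)).hasFDerivAt.comp y (w : Vec m →L[ℝ] Vec m).hasFDerivAt).fderiv
  unfold rho
  rw [h]
  simp [rootRefl_map]

theorem dunklAt_comp_rootRefl (hR : IsRootSystem R) (hRp : IsPositiveSubsystem R Rp)
    (hκ : IsMultiplicity R κ) {β : Vec m} (hβ : β ∈ R) (a : Vec m) {g : Vec m → V}
    (hg : Differentiable ℝ g) :
    dunklAt Rp κ a (g ∘ rootRefl β) = dunklAt Rp κ (rootRefl β a) g ∘ rootRefl β := by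
  ext y
  have h : fderiv ℝ (g ∘ rootRefl β) y =
      (fderiv ℝ g (rootRefl β y)).comp (rootRefl β : Vec m →L[ℝ] Vec m) :=
    ((hg (rootRefl β y)).hasFDerivAt.comp y (rootRefl β : Vec m →L[ℝ] Vec m).hasFDerivAt).fderiv
  rw [Function.comp_apply, dunklAt_eq_sum_roots hR hRp hκ, dunklAt_eq_sum_roots hR hRp hκ, h]
  refine congrArg₂ (· + ·) rfl (congrArg _ ?_)
  refine Finset.sum_nbij' (rootRefl β) (rootRefl β) (fun α hα => hR.rootRefl_mem hβ hα)
    (fun α hα => hR.rootRefl_mem hβ hα) (fun α _ => rootRefl_rootRefl β α)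
    (fun α _ => rootRefl_rootRefl β α) fun α hα => ?_
  rw [rho_comp_isometry _ _ hg, hκ.rootRefl hβ hα, (rootRefl β).inner_map_map]

/-- Dunkl operators commute on polynomials. -/
theorem HomPoly.dunklAt_comm (hR : IsRootSystem R) (hRp : IsPositiveSubsystem R Rp)
    (hκ : IsMultiplicity R κ) (a b : Vec m) {k : ℕ} {B : ℝ} {g : Vec m → V} (hg : HomPoly k B g) :
    DunklSlice.dunklAt Rp κ a (DunklSlice.dunklAt Rp κ b g) =
      DunklSlice.dunklAt Rp κ b (DunklSlice.dunklAt Rp κ a g) := by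
  induction hg with
  | const c => simp [dunklAt_const, dunklAt_zero]
  | zero k => simp [dunklAt_zero]
  | add h1 h2 ih1 ih2 =>
    simp only [dunklAt_add _ _ _ h1.differentiable h2.differentiable,
      dunklAt_add _ _ _ (h1.dunklAt Rp κ _).differentiable (h2.dunklAt Rp κ _).differentiable,
      ih1, ih2]
  | @mul k B g x hg ih =>
    -- Moving both operators past the linear form leaves the commutator on `g`, settled by
    -- induction, and terms symmetric in `a` and `b`. The last correction comes from `σ_α a = a -
    -- 2⟨α, a⟩/|α|² α` in the equivariance relation, and its coefficient contains `⟨α, a⟩⟨α, b⟩`.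
    have key : ∀ a b : Vec m, DunklSlice.dunklAt Rp κ a (DunklSlice.dunklAt Rp κ b
        (fun z => inner ℝ x z • g z)) =
        (fun y => inner ℝ x y • DunklSlice.dunklAt Rp κ a (DunklSlice.dunklAt Rp κ b g) y) +
        (inner ℝ x a • DunklSlice.dunklAt Rp κ b g + inner ℝ x b • DunklSlice.dunklAt Rp κ a g) +
        ∑ α ∈ Rp, ((κ α * inner ℝ α a * (2 * inner ℝ α x / ‖α‖ ^ 2)) •
            (DunklSlice.dunklAt Rp κ b g ∘ rootRefl α) +
          (κ α * inner ℝ α b * (2 * inner ℝ α x / ‖α‖ ^ 2)) •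
            (DunklSlice.dunklAt Rp κ a g ∘ rootRefl α) -
          (κ α * (2 * inner ℝ α x / ‖α‖ ^ 2) * (2 / ‖α‖ ^ 2) * inner ℝ α a * inner ℝ α b) •
            (DunklSlice.dunklAt Rp κ α g ∘ rootRefl α)) := by
      intro a b
      have hd := hg.differentiable
      have hb := hg.dunklAt Rp κ b
      have hs : ∀ α ∈ Rp, Differentiable ℝ
          ((κ α * inner ℝ α b * (2 * inner ℝ α x / ‖α‖ ^ 2)) • (g ∘ rootRefl α)) := fun α _ =>
        ((hg.comp_rootRefl α).const_smul _).differentiable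
      have hS : Differentiable ℝ (∑ α ∈ Rp,
          (κ α * inner ℝ α b * (2 * inner ℝ α x / ‖α‖ ^ 2)) • (g ∘ rootRefl α)) :=
        Differentiable.sum hs
      have hx : Differentiable ℝ (fun y => inner ℝ x y • DunklSlice.dunklAt Rp κ b g y) :=
        (hb.mul x).differentiable
      have hxb : Differentiable ℝ ((inner ℝ x b : ℝ) • g) := hd.const_smul _
      rw [dunklAt_inner_smul _ _ _ _ hd, dunklAt_add _ _ _ (hx.add hxb) hS,
        dunklAt_add _ _ _ hx hxb,
        dunklAt_inner_smul _ _ _ _ hb.differentiable, dunklAt_smul _ _ _ _ hd,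
        dunklAt_sum _ _ _ _ hs]
      have hterm : ∀ α ∈ Rp, DunklSlice.dunklAt Rp κ a
          ((κ α * inner ℝ α b * (2 * inner ℝ α x / ‖α‖ ^ 2)) • (g ∘ rootRefl α)) =
          (κ α * inner ℝ α b * (2 * inner ℝ α x / ‖α‖ ^ 2)) •
            (DunklSlice.dunklAt Rp κ a g ∘ rootRefl α) -
          (κ α * (2 * inner ℝ α x / ‖α‖ ^ 2) * (2 / ‖α‖ ^ 2) * inner ℝ α a * inner ℝ α b) •
            (DunklSlice.dunklAt Rp κ α g ∘ rootRefl α) := by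
        intro α hα
        obtain ⟨v, hv, hmem⟩ := id hRp
        rw [dunklAt_smul _ _ _ _ (hg.comp_rootRefl α).differentiable,
          dunklAt_comp_rootRefl hR hRp hκ ((hmem α).1 hα).1 _ hd, rootRefl_apply, sub_eq_add_neg,
          ← neg_smul, dunklAt_add_dir, dunklAt_smul_dir]
        ext y
        simp only [Function.comp_apply, Pi.smul_apply, Pi.add_apply, Pi.sub_apply]
        module
      rw [Finset.sum_congr rfl hterm]
      simp only [add_sub_assoc, Finset.sum_add_distrib]
      abel
    rw [key a b, key b a, ih]
    congr 1
    · congr 1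
      exact add_comm _ _
    · refine Finset.sum_congr rfl fun α _ => ?_
      rw [add_comm (_ • _) (_ • _), mul_right_comm _ (inner ℝ α a) (inner ℝ α b)]
  | mono h _ ih => exact ih

/-! ### Iterates of Dunkl operators on polynomials -/

theorem HomPoly.iterate_dunklAt_add (a : Vec m) (n : ℕ) {k : ℕ} {B C : ℝ} {g h : Vec m → V}
    (hg : HomPoly k B g) (hh : HomPoly k C h) :
    (DunklSlice.dunklAt Rp κ a)^[n] (g + h) =
      (DunklSlice.dunklAt Rp κ a)^[n] g + (DunklSlice.dunklAt Rp κ a)^[n] h := by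
  induction n generalizing k B C g h with
  | zero => rfl
  | succ n ih =>
    simp only [Function.iterate_succ_apply, dunklAt_add _ _ _ hg.differentiable hh.differentiable]
    exact ih (hg.dunklAt Rp κ a) (hh.dunklAt Rp κ a)

theorem HomPoly.iterate_dunklAt_clm_comp (a : Vec m) (n : ℕ) (L : V →L[ℝ] W) {k : ℕ} {B : ℝ}
    {g : Vec m → V} (hg : HomPoly k B g) :
    (DunklSlice.dunklAt Rp κ a)^[n] (fun y => L (g y)) =
      fun y => L ((DunklSlice.dunklAt Rp κ a)^[n] g y) := by
  induction n generalizing k B g with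
  | zero => rfl
  | succ n ih =>
    simp only [Function.iterate_succ_apply, dunklAt_clm_comp _ _ _ L hg.differentiable]
    exact ih (hg.dunklAt Rp κ a)

theorem HomPoly.iterate_dunklAt_smul (a : Vec m) (n : ℕ) (c : ℝ) {k : ℕ} {B : ℝ}
    {g : Vec m → V} (hg : HomPoly k B g) :
    (DunklSlice.dunklAt Rp κ a)^[n] (c • g) = c • (DunklSlice.dunklAt Rp κ a)^[n] g :=
  hg.iterate_dunklAt_clm_comp a n (c • ContinuousLinearMap.id ℝ V)

theorem iterate_dunklAt_zero (a : Vec m) (n : ℕ) :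
    (DunklSlice.dunklAt Rp κ a)^[n] (0 : Vec m → V) = 0 := by
  induction n with
  | zero => rfl
  | succ n ih => rw [Function.iterate_succ_apply, dunklAt_zero, ih]

theorem HomPoly.iterate_dunklAt_sum {ι : Type*} (s : Finset ι) (a : Vec m) (n : ℕ) {k : ℕ}
    {b : ι → ℝ} {g : ι → Vec m → V} (hg : ∀ i ∈ s, HomPoly k (b i) (g i)) :
    (DunklSlice.dunklAt Rp κ a)^[n] (∑ i ∈ s, g i) =
      ∑ i ∈ s, (DunklSlice.dunklAt Rp κ a)^[n] (g i) := by
  classical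
  induction s using Finset.induction_on with
  | empty => simp [iterate_dunklAt_zero]
  | insert i s hi ih =>
    have h1 := fun j hj => hg j (Finset.mem_insert_of_mem hj)
    rw [Finset.sum_insert hi, Finset.sum_insert hi,
      (hg i (Finset.mem_insert_self _ _)).iterate_dunklAt_add a n (HomPoly.sum h1), ih h1]

theorem HomPoly.iterate_dunklAt_succ_eq_sum (x : Vec m) (n : ℕ) {k : ℕ} {B : ℝ} {g : Vec m → V}
    (hg : HomPoly k B g) :
    (DunklSlice.dunklAt Rp κ x)^[n + 1] g =
      ∑ j, x j • (DunklSlice.dunklAt Rp κ x)^[n] (DunklSlice.dunklAt Rp κ (stdVec j) g) := by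
  rw [Function.iterate_succ_apply]
  conv_lhs => rw [← sum_smul_stdVec x, dunklAt_sum_dir, sum_smul_stdVec]
  simp only [dunklAt_smul_dir]
  rw [HomPoly.iterate_dunklAt_sum _ _ _ fun j _ => (hg.dunklAt Rp κ (stdVec j)).const_smul (x j)]
  exact Finset.sum_congr rfl fun j _ =>
    (hg.dunklAt Rp κ (stdVec j)).iterate_dunklAt_smul x n (x j)

/-- Writing the innermost operator as `∑ xⱼ Tⱼ` extracts one linear form in `x` per iteration. The
value of the bound is irrelevant; only polynomiality and the degree in `x` are used. -/
theorem HomPoly.exists_iterate_dunklAt_apply_zero (n : ℕ) {k : ℕ} {B : ℝ} {g : Vec m → V}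
    (hg : HomPoly k B g) :
    ∃ C, HomPoly n C (fun x => (DunklSlice.dunklAt Rp κ x)^[n] g 0) := by
  induction n generalizing k B g with
  | zero => exact ⟨_, HomPoly.const (g 0)⟩
  | succ n ih =>
    choose C hC using fun j => ih (hg.dunklAt Rp κ (stdVec j))
    have : (fun x => (DunklSlice.dunklAt Rp κ x)^[n + 1] g 0) = ∑ j, fun x : Vec m =>
        inner ℝ (stdVec j) x •
          (DunklSlice.dunklAt Rp κ x)^[n] (DunklSlice.dunklAt Rp κ (stdVec j) g) 0 := by
      ext x
      rw [hg.iterate_dunklAt_succ_eq_sum]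
      simp [real_inner_comm x, inner_stdVec]
    rw [this]
    exact ⟨_, HomPoly.sum fun j _ => (hC j).mul (stdVec j)⟩

theorem HomPoly.fderiv_inner_smul (x : Vec m) {k : ℕ} {B : ℝ} {g : Vec m → V}
    (hg : HomPoly k B g) (y v : Vec m) :
    fderiv ℝ (fun z => inner ℝ x z • g z) y v =
      inner ℝ x y • fderiv ℝ g y v + inner ℝ x v • g y := by
  have := congrFun (dunklAt_inner_smul ∅ (fun _ => 0) v x hg.differentiable) y
  simpa [dunklAt_empty] using this

/-- The derivative in `x` of `T_xⁿ g (0)`. -/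
theorem HomPoly.fderiv_iterate_dunklAt_apply_zero (hR : IsRootSystem R)
    (hRp : IsPositiveSubsystem R Rp) (hκ : IsMultiplicity R κ) (n : ℕ) {k : ℕ} {B : ℝ}
    {g : Vec m → V} (hg : HomPoly k B g) (x v : Vec m) :
    fderiv ℝ (fun x => (DunklSlice.dunklAt Rp κ x)^[n] g 0) x v =
      (n : ℝ) • (DunklSlice.dunklAt Rp κ x)^[n - 1] (DunklSlice.dunklAt Rp κ v g) 0 := by
  induction n generalizing k B g with
  | zero => simp
  | succ n ih =>
    have hj := fun j => hg.dunklAt Rp κ (stdVec j)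
    choose C hC using fun j =>
      (hj j).exists_iterate_dunklAt_apply_zero (Rp := Rp) (κ := κ) n
    have h1 : (fun x => (DunklSlice.dunklAt Rp κ x)^[n + 1] g 0) = fun x => ∑ j,
        inner ℝ (stdVec j) x •
          (DunklSlice.dunklAt Rp κ x)^[n] (DunklSlice.dunklAt Rp κ (stdVec j) g) 0 := by
      ext x
      rw [hg.iterate_dunklAt_succ_eq_sum]
      simp [real_inner_comm x, inner_stdVec]
    rw [h1, fderiv_fun_sum fun j _ => ((hC j).mul (stdVec j)).differentiable x]
    simp only [sum_apply, (hC _).fderiv_inner_smul, ih (hj _),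
      Finset.sum_add_distrib, real_inner_comm x, real_inner_comm v, inner_stdVec]
    have hv := congrFun (HomPoly.iterate_dunklAt_sum (Rp := Rp) (κ := κ) Finset.univ x n
      fun j _ => (hj j).const_smul (v j)) 0
    simp only [← dunklAt_smul_dir, ← dunklAt_sum_dir, sum_smul_stdVec] at hv
    simp only [dunklAt_smul_dir, (hj _).iterate_dunklAt_smul] at hv
    rw [Finset.sum_apply] at hv
    simp only [Pi.smul_apply] at hv
    rw [← hv]
    rcases n with _ | n
    · simp
    -- Commutativity enters here: with `T_v` moved past `Tⱼ`, the Leibniz terms `xⱼ T_xⁿ T_v Tⱼ g`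
    -- reassemble into `T_x^{n+1} T_v g`.
    · have h2 : (DunklSlice.dunklAt Rp κ x)^[n + 1] (DunklSlice.dunklAt Rp κ v g) 0 =
          ∑ j, x j • (DunklSlice.dunklAt Rp κ x)^[n]
            (DunklSlice.dunklAt Rp κ v (DunklSlice.dunklAt Rp κ (stdVec j) g)) 0 := by
        rw [(hg.dunklAt Rp κ v).iterate_dunklAt_succ_eq_sum, Finset.sum_apply]
        refine Finset.sum_congr rfl fun j _ => ?_
        rw [hg.dunklAt_comm hR hRp hκ, Pi.smul_apply]
      simp only [Nat.add_sub_cancel]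
      simp_rw [smul_comm (x _), ← Finset.smul_sum, ← h2]
      push_cast
      module

end Commutativity

section Dirac

variable {m : ℕ} {V : Type*} [NormedAddCommGroup V] [NormedSpace ℝ V]
  {R Rp : Finset (Vec m)} {κ : Vec m → ℝ}

/-! ### The Clifford algebra -/

/-- The product of the Clifford algebra as a continuous bilinear map. -/
def mulL (m : ℕ) : Cl m →L[ℝ] Cl m →L[ℝ] Cl m := (LinearMap.mul ℝ (Cl m)).toContinuousBilinearMap

@[simp]
theorem mulL_apply (a b : Cl m) : mulL m a b = a * b := rfl

/-- The embedding of vectors as a continuous linear map. -/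
def vecL (m : ℕ) : Vec m →L[ℝ] Cl m := (CliffordAlgebra.ι (negForm m)).toContinuousLinearMap

@[simp]
theorem vecL_apply (v : Vec m) : vecL m v = vec v := rfl

theorem vec_mul_self (v : Vec m) : vec v * vec v = (-‖v‖ ^ 2) • (1 : Cl m) := by
  rw [vec, CliffordAlgebra.ι_sq_scalar, Algebra.algebraMap_eq_smul_one]
  congr 1
  simp [negForm]

theorem vec_mul_vec_add (v w : Vec m) :
    vec v * vec w + vec w * vec v = (-2 * inner ℝ v w) • (1 : Cl m) := by
  have h := vec_mul_self (v + w)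
  have hv : vec (v + w) = vec v + vec w := (vecL m).map_add v w
  rw [hv, add_mul, mul_add, mul_add, vec_mul_self, vec_mul_self, norm_add_sq_real] at h
  have : vec v * vec w + vec w * vec v =
      (-(‖v‖ ^ 2 + 2 * inner ℝ v w + ‖w‖ ^ 2)) • (1 : Cl m) - (-‖v‖ ^ 2) • (1 : Cl m) -
        (-‖w‖ ^ 2) • (1 : Cl m) := by
    rw [← h]; abel
  rw [this]
  module

theorem sum_smul_e (y : Vec m) : ∑ j, y j • (e j : Cl m) = vec y := by
  conv_rhs => rw [← sum_smul_stdVec y, ← vecL_apply, map_sum]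
  simp [e]

theorem vec_mul_eq_sum (y : Vec m) (c : Cl m) :
    vec y * c = ∑ j, inner ℝ (stdVec j) y • (e j * c) := by
  rw [← sum_smul_e y, Finset.sum_mul]
  simp [real_inner_comm y, inner_stdVec]

theorem e_mul_e_self (j : Fin m) : (e j : Cl m) * e j = -1 := by
  rw [e, vec_mul_self]
  simp [stdVec]

/-- The sum of the norms of left multiplication by the generators. -/
def genBound (m : ℕ) : ℝ := ∑ j : Fin m, ‖mulL m (e j)‖

theorem genBound_nonneg (m : ℕ) : 0 ≤ genBound m := Finset.sum_nonneg fun _ _ => norm_nonneg _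

theorem norm_stdVec (j : Fin m) : ‖(stdVec j : Vec m)‖ = 1 := by simp [stdVec]

theorem HomPoly.vec_mul {k : ℕ} {B : ℝ} {g : Vec m → Cl m} (hg : HomPoly k B g) :
    HomPoly (k + 1) (genBound m * B) (fun y => vec y * g y) := by
  have h1 : (fun y => vec y * g y) = ∑ j, fun y => inner ℝ (stdVec j) y • (e j * g y) := by
    ext y : 1
    rw [vec_mul_eq_sum, Finset.sum_apply]
  have h2 := HomPoly.sum (s := Finset.univ) fun j _ => (hg.clm_comp (mulL m (e j))).mul (stdVec j)
  simp only [norm_stdVec, one_mul, ← Finset.sum_mul] at h2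
  rw [h1]
  exact h2

theorem homPoly_vec_pow (m n : ℕ) :
    HomPoly n (genBound m ^ n * ‖(1 : Cl m)‖) (fun y : Vec m => vec y ^ n) := by
  induction n with
  | zero => simpa using HomPoly.const (1 : Cl m)
  | succ n ih =>
    simp only [pow_succ']
    rw [mul_assoc]
    exact ih.vec_mul

/-! ### The Dunkl-Dirac operator -/

/-- Euler's identity. -/
theorem HomPoly.fderiv_self {k : ℕ} {B : ℝ} {g : Vec m → V} (hg : HomPoly k B g) (y : Vec m) :
    fderiv ℝ g y y = (k : ℝ) • g y := by
  induction hg with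
  | const c => simp
  | zero k => simp
  | add h1 h2 ih1 ih2 => simp [fderiv_add (h1.differentiable y) (h2.differentiable y), ih1, ih2]
  | mul x hg ih =>
    rw [hg.fderiv_inner_smul, ih]
    push_cast
    module
  | mono h _ ih => exact ih

/-- In the radial direction Euler's identity gives the degree, and the factor `⟨α, y⟩` cancels the
denominator of each difference quotient. -/
theorem HomPoly.dunklAt_self (Rp : Finset (Vec m)) (κ : Vec m → ℝ) {k : ℕ} {B : ℝ}
    {g : Vec m → V} (hg : HomPoly k B g) (y : Vec m) :
    DunklSlice.dunklAt Rp κ y g y =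
      ((k : ℝ) + index Rp κ) • g y - ∑ α ∈ Rp, κ α • g (rootRefl α y) := by
  rw [DunklSlice.dunklAt, hg.fderiv_self, add_smul, index, Finset.sum_smul, add_sub_assoc,
    ← Finset.sum_sub_distrib]
  congr 1
  refine Finset.sum_congr rfl fun α _ => ?_
  rw [mul_smul, inner_smul_rho, smul_sub]

theorem HomPoly.dunklAt_vec_mul (Rp : Finset (Vec m)) (κ : Vec m → ℝ) (a : Vec m) {k : ℕ} {B : ℝ}
    {g : Vec m → Cl m} (hg : HomPoly k B g) (y : Vec m) :
    DunklSlice.dunklAt Rp κ a (fun y => vec y * g y) y =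
      vec y * DunklSlice.dunklAt Rp κ a g y + vec a * g y +
      ∑ α ∈ Rp, (κ α * inner ℝ α a * (2 / ‖α‖ ^ 2)) • (vec α * g (rootRefl α y)) := by
  have h1 : (fun y => vec y * g y) = ∑ j, fun y => inner ℝ (stdVec j) y • mulL m (e j) (g y) := by
    ext y : 1
    rw [vec_mul_eq_sum, Finset.sum_apply]
    rfl
  have hj := fun j => hg.clm_comp (mulL m (e j))
  rw [h1, dunklAt_sum _ _ _ _ fun j _ => ((hj j).mul (stdVec j)).differentiable]
  simp only [dunklAt_inner_smul _ _ _ _ (hj _).differentiable, Finset.sum_apply, Pi.add_apply,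
    Pi.smul_apply, Function.comp_apply, Finset.sum_add_distrib,
    dunklAt_clm_comp _ _ _ _ hg.differentiable]
  simp only [mulL_apply, ← vec_mul_eq_sum]
  congr 1
  rw [Finset.sum_comm]
  refine Finset.sum_congr rfl fun α _ => ?_
  rw [vec_mul_eq_sum, Finset.smul_sum]
  refine Finset.sum_congr rfl fun j _ => ?_
  rw [smul_smul, real_inner_comm α]
  congr 1
  ring

/-- The Dunkl-Dirac operator `∑ⱼ eⱼ Tⱼ`. -/
def dunklDirac (Rp : Finset (Vec m)) (κ : Vec m → ℝ) (g : Vec m → Cl m) (y : Vec m) : Cl m :=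
  ∑ j, e j * dunklAt Rp κ (stdVec j) g y

theorem sum_stdVec_mul_dunklAt (Rp : Finset (Vec m)) (κ : Vec m → ℝ) (x : Vec m)
    (g : Vec m → V) (y : Vec m) :
    ∑ j, x j • dunklAt Rp κ (stdVec j) g y = dunklAt Rp κ x g y := by
  conv_rhs => rw [← sum_smul_stdVec x, dunklAt_sum_dir]
  simp [dunklAt_smul_dir]

/-- Anticommuting `eⱼ` past `vec y` produces `-2 T_y g`, which contains `-2(k + γ) g` and twice the
reflected sum; the product rule contributes `-m g` and minus twice the same sum. The reflected
values cancel and the factor `2k + 2γ + m` remains, which is `2k + 1` for the given index. -/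
theorem HomPoly.dunklDirac_vec_mul (h0 : (0 : Vec m) ∉ Rp)
    (hγ : index Rp κ = (1 - (m : ℝ)) / 2) {k : ℕ} {B : ℝ} {g : Vec m → Cl m}
    (hg : HomPoly k B g) (y : Vec m) :
    dunklDirac Rp κ (fun y => vec y * g y) y =
      -(vec y * dunklDirac Rp κ g y) - (2 * (k : ℝ) + 1) • g y := by
  simp only [dunklDirac, hg.dunklAt_vec_mul, mul_add, Finset.sum_add_distrib]
  have h1 : ∑ j, e j * (vec y * DunklSlice.dunklAt Rp κ (stdVec j) g y) =
      -(vec y * dunklDirac Rp κ g y) - (2 : ℝ) • DunklSlice.dunklAt Rp κ y g y := by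
    rw [← sum_stdVec_mul_dunklAt, dunklDirac, Finset.mul_sum, Finset.smul_sum,
      ← Finset.sum_neg_distrib, ← Finset.sum_sub_distrib]
    refine Finset.sum_congr rfl fun j _ => ?_
    have h := vec_mul_vec_add (stdVec j) y
    rw [real_inner_comm, inner_stdVec] at h
    rw [← mul_assoc, ← mul_assoc, show (e j : Cl m) * vec y = (-2 * y j) • 1 - vec y * e j from
      eq_sub_of_add_eq h, sub_mul, smul_mul_assoc, one_mul]
    module
  have h2 : ∑ j : Fin m, e j * (vec (stdVec j) * g y) = -(m : ℝ) • g y := by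
    simp_rw [← mul_assoc]
    have : ∀ j : Fin m, (e j : Cl m) * vec (stdVec j) = -1 := e_mul_e_self
    simp only [this, neg_one_mul, Finset.sum_const, Finset.card_univ, Fintype.card_fin, smul_neg]
    rw [← Nat.cast_smul_eq_nsmul ℝ]
    exact (neg_smul _ _).symm
  have h3 : ∑ j : Fin m, e j * ∑ α ∈ Rp,
      (κ α * inner ℝ α (stdVec j) * (2 / ‖α‖ ^ 2)) • (vec α * g (rootRefl α y)) =
      -(2 : ℝ) • ∑ α ∈ Rp, κ α • g (rootRefl α y) := by
    simp_rw [Finset.mul_sum]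
    rw [Finset.sum_comm, Finset.smul_sum]
    refine Finset.sum_congr rfl fun α hα => ?_
    have hα0 : ‖α‖ ≠ 0 := norm_ne_zero_iff.2 (ne_of_mem_of_not_mem hα h0)
    have : ∀ j : Fin m, e j * ((κ α * inner ℝ α (stdVec j) * (2 / ‖α‖ ^ 2)) •
        (vec α * g (rootRefl α y))) =
        (κ α * (2 / ‖α‖ ^ 2)) • (inner ℝ (stdVec j) α • (e j * (vec α * g (rootRefl α y)))) := by
      intro j
      rw [mul_smul_comm, smul_smul, real_inner_comm α]
      congr 1
      ring
    simp_rw [this]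
    rw [← Finset.smul_sum, ← vec_mul_eq_sum, ← mul_assoc, vec_mul_self, smul_mul_assoc, one_mul,
      smul_smul, smul_smul]
    congr 1
    field_simp
  have h4 : ∀ {M : Type} [AddCommGroup M] [Module ℝ M] (A G S : M),
      -A - (2 : ℝ) • (((k : ℝ) + (1 - (m : ℝ)) / 2) • G - S) + -(m : ℝ) • G + -(2 : ℝ) • S =
        -A - (2 * (k : ℝ) + 1) • G := fun A G S => by module
  rw [h1, h2, h3, hg.dunklAt_self, hγ]
  exact h4 _ _ _

/-- The preceding relation with `g = vec y ^ n` gives the recursion `n - (2n + 1) = -(n + 1)` for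
the coefficient. -/
theorem dunklDirac_vec_pow (h0 : (0 : Vec m) ∉ Rp) (hγ : index Rp κ = (1 - (m : ℝ)) / 2)
    (n : ℕ) (y : Vec m) :
    dunklDirac Rp κ (fun y => vec y ^ n) y = -(n : ℝ) • vec y ^ (n - 1) := by
  induction n with
  | zero => simp [dunklDirac, dunklAt_const]
  | succ n ih =>
    simp only [pow_succ']
    rw [(homPoly_vec_pow m n).dunklDirac_vec_mul h0 hγ, ih]
    rcases n with _ | n
    · simp
    · simp only [Nat.add_sub_cancel, mul_smul_comm, ← pow_succ']
      push_cast
      module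

/-! ### The images of the powers of the vector variable -/

/-- The polynomial `1/n! (T_x)ⁿ yⁿ` of `x`, the image of the `n`-th power of the vector variable. -/
def dunklPow (Rp : Finset (Vec m)) (κ : Vec m → ℝ) (n : ℕ) (x : Vec m) : Cl m :=
  (n.factorial : ℝ)⁻¹ • (dunklAt Rp κ x)^[n] (fun y => vec y ^ n) 0

theorem exists_homPoly_dunklPow (Rp : Finset (Vec m)) (κ : Vec m → ℝ) (n : ℕ) :
    ∃ B, HomPoly n B (dunklPow Rp κ n) := by
  obtain ⟨C, hC⟩ := (homPoly_vec_pow m n).exists_iterate_dunklAt_apply_zero (Rp := Rp) (κ := κ) n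
  exact ⟨_, hC.const_smul _⟩

/-- Applying `n` operators in degree `n` costs the falling factorial `n!`, exactly cancelled by the
normalization of `dunklPow`. -/
theorem norm_dunklPow_le (Rp : Finset (Vec m)) (κ : Vec m → ℝ) (n : ℕ) (x : Vec m) :
    ‖dunklPow Rp κ n x‖ ≤ (dunklBound Rp κ * genBound m * ‖x‖) ^ n * ‖(1 : Cl m)‖ := by
  have h := ((homPoly_vec_pow m n).iterate_dunklAt Rp κ x n).norm_le 0
  rw [Nat.sub_self, pow_zero, mul_one, Nat.descFactorial_self] at h
  have hn : (0 : ℝ) < n.factorial := by exact_mod_cast n.factorial_pos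
  rw [dunklPow, norm_smul, norm_inv, Real.norm_of_nonneg hn.le, inv_mul_le_iff₀ hn]
  refine h.trans (le_of_eq ?_)
  ring

/-- Differentiating in `x` turns one `T_x` into `Tⱼ` acting directly on `vec y ^ n`; summed against
`eⱼ`, this is the Dunkl-Dirac operator. Hence the ordinary Dirac operator in `x` corresponds to the
Dunkl-Dirac operator in `y`. -/
theorem dirac_dunklPow (hR : IsRootSystem R) (hRp : IsPositiveSubsystem R Rp)
    (hκ : IsMultiplicity R κ) (hγ : index Rp κ = (1 - (m : ℝ)) / 2) (n : ℕ) (x : Vec m) :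
    ∑ j : Fin m, e j * fderiv ℝ (dunklPow Rp κ n) x (stdVec j) =
      -(n : ℝ) • dunklPow Rp κ (n - 1) x := by
  have hp := homPoly_vec_pow m n
  obtain ⟨C, hC⟩ := hp.exists_iterate_dunklAt_apply_zero (Rp := Rp) (κ := κ) n
  have h0 : (0 : Vec m) ∉ Rp := by
    obtain ⟨v, hv, hmem⟩ := hRp
    exact fun h => hR.zero_notMem ((hmem 0).1 h).1
  have h1 : ∀ v, fderiv ℝ (dunklPow Rp κ n) x v = ((n.factorial : ℝ)⁻¹ * n) •
      (dunklAt Rp κ x)^[n - 1] (dunklAt Rp κ v fun y => vec y ^ n) 0 := by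
    intro v
    have : dunklPow Rp κ n = (n.factorial : ℝ)⁻¹ • fun x => (dunklAt Rp κ x)^[n]
      (fun y => vec y ^ n) 0 := rfl
    rw [this, fderiv_const_smul (hC.differentiable x), smul_apply,
      hp.fderiv_iterate_dunklAt_apply_zero hR hRp hκ, smul_smul]
  have h2 : ∑ j : Fin m, e j * (dunklAt Rp κ x)^[n - 1]
      (dunklAt Rp κ (stdVec j) fun y => vec y ^ n) 0 =
      -(n : ℝ) • (dunklAt Rp κ x)^[n - 1] (fun y => vec y ^ (n - 1)) 0 := by
    have hj := fun j : Fin m => (hp.dunklAt Rp κ (stdVec j)).clm_comp (mulL m (e j))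
    have := congrFun (HomPoly.iterate_dunklAt_sum (Rp := Rp) (κ := κ) Finset.univ x (n - 1)
      fun j _ => hj j) 0
    simp only [(hp.dunklAt Rp κ _).iterate_dunklAt_clm_comp, Finset.sum_apply] at this
    simp only [mulL_apply] at this
    rw [← this]
    have h3 : (∑ j : Fin m, fun y => (e j : Cl m) * dunklAt Rp κ (stdVec j)
        (fun y => vec y ^ n) y) = -(n : ℝ) • fun y => vec y ^ (n - 1) := by
      ext y : 1
      rw [Finset.sum_apply]
      exact dunklDirac_vec_pow h0 hγ n y
    rw [h3, (homPoly_vec_pow m (n - 1)).iterate_dunklAt_smul]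
    rfl
  simp_rw [h1, mul_smul_comm]
  rw [← Finset.smul_sum, h2, dunklPow, smul_smul, smul_smul]
  rcases n with _ | n
  · simp
  · congr 1
    rw [Nat.add_sub_cancel, Nat.factorial_succ]
    have : (n.factorial : ℝ) ≠ 0 := by exact_mod_cast n.factorial_ne_zero
    push_cast
    field_simp

end Dirac

section Expansions

variable {m : ℕ} {V : Type*} [NormedAddCommGroup V] [NormedSpace ℝ V]

/-! ### Dunkl operators on convergent series of homogeneous polynomials -/

/-- `g` is near `0` the sum of a series of homogeneous polynomials `G k` of degree `k` that
converges normally. -/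
def HasHomExpansion (g : Vec m → V) (G : ℕ → Vec m → V) : Prop :=
  ∃ r > 0, ∃ B : ℕ → ℝ, (∀ k, HomPoly k (B k) (G k)) ∧ Summable (fun k => B k * r ^ k) ∧
    ∀ y, ‖y‖ < r → HasSum (fun k => G k y) (g y)

theorem HomPoly.norm_fderiv_le {k : ℕ} {B : ℝ} {g : Vec m → V} (hg : HomPoly k B g) (y : Vec m) :
    ‖fderiv ℝ g y‖ ≤ k * B * ‖y‖ ^ (k - 1) := by
  have hB := hg.nonneg
  refine ContinuousLinearMap.opNorm_le_bound _ (by positivity) fun a => ?_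
  have h := (hg.dunklAt ∅ (fun _ => 0) a).norm_le y
  rw [dunklAt_empty] at h
  refine h.trans (le_of_eq ?_)
  simp [dunklBound]
  ring

theorem natCast_mul_half_pow_le (k : ℕ) {B r : ℝ} (hB : 0 ≤ B) (hr : 0 < r) :
    k * B * (r / 2) ^ (k - 1) ≤ 2 / r * (B * r ^ k) := by
  rcases k with _ | k
  · simp; positivity
  · have h : ((k + 1 : ℕ) : ℝ) ≤ 2 ^ (k + 1) := by exact_mod_cast (Nat.lt_two_pow_self).le
    rw [Nat.add_sub_cancel, div_pow]
    calc ((k + 1 : ℕ) : ℝ) * B * (r ^ k / 2 ^ k) ≤ 2 ^ (k + 1) * B * (r ^ k / 2 ^ k) := by gcongr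
      _ = 2 / r * (B * r ^ (k + 1)) := by field_simp; ring

/-- Halving the radius absorbs the factor `k` from differentiation, since `k ≤ 2 ^ k`. Finitely many
halvings are harmless because only the value at `0` is wanted in the end. The index shifts by one as
the constant term is annihilated. -/
theorem HasHomExpansion.dunklAt [CompleteSpace V] (Rp : Finset (Vec m)) (κ : Vec m → ℝ)
    (a : Vec m) {g : Vec m → V} {G : ℕ → Vec m → V} (h : HasHomExpansion g G) :
    HasHomExpansion (dunklAt Rp κ a g) (fun k => dunklAt Rp κ a (G (k + 1))) := by
  obtain ⟨r, hr, B, hG, hB, hsum⟩ := h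
  have hB0 := fun k => (hG k).nonneg
  have hu : Summable fun k : ℕ => k * B k * (r / 2) ^ (k - 1) :=
    Summable.of_nonneg_of_le (fun k => by have := hB0 k; positivity)
      (fun k => natCast_mul_half_pow_le k (hB0 k) hr) (hB.mul_left (2 / r))
  have hbd : ∀ k, ∀ y ∈ Metric.ball (0 : Vec m) (r / 2),
      ‖fderiv ℝ (G k) y‖ ≤ k * B k * (r / 2) ^ (k - 1) := by
    intro k y hy
    rw [mem_ball_zero_iff] at hy
    have := hB0 k
    exact ((hG k).norm_fderiv_le y).trans (by gcongr)
  have hlt : ∀ y : Vec m, ‖y‖ < r / 2 → ‖y‖ < r := fun y hy => hy.trans (by linarith)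
  have hder : ∀ y : Vec m, ‖y‖ < r / 2 → HasSum (fun k => fderiv ℝ (G k) y) (fderiv ℝ g y) := by
    intro y hy
    have hy' : y ∈ Metric.ball (0 : Vec m) (r / 2) := mem_ball_zero_iff.2 hy
    have h1 : HasFDerivAt (fun z => ∑' k, G k z) (∑' k, fderiv ℝ (G k) y) y :=
      hasFDerivAt_tsum_of_isPreconnected hu Metric.isOpen_ball
        (convex_ball _ _).isPreconnected (fun k z _ => ((hG k).differentiable z).hasFDerivAt) hbd
        (Metric.mem_ball_self (half_pos hr)) (hsum 0 (by simpa using hr)).summable hy'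
    have h2 : g =ᶠ[𝓝 y] fun z => ∑' k, G k z := by
      filter_upwards [Metric.isOpen_ball.mem_nhds hy'] with z hz
      exact (hsum z (hlt z (mem_ball_zero_iff.1 hz))).tsum_eq.symm
    rw [(h1.congr_of_eventuallyEq h2).fderiv]
    exact (Summable.of_norm_bounded hu fun k => hbd k y hy').hasSum
  -- On the hyperplane this needs the differentiated series; off it, convergence at `y` and at its
  -- reflection, which has the same norm.
  have hrho : ∀ α y : Vec m, ‖y‖ < r / 2 → HasSum (fun k => rho α (G k) y) (rho α g y) := by
    intro α y hy
    unfold rho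
    split_ifs
    · exact ((hder y hy).mapL (ContinuousLinearMap.apply ℝ V α)).const_smul _
    · exact ((hsum y (hlt y hy)).sub (hsum _ (by rw [norm_rootRefl]; exact hlt y hy))).const_smul _
  refine ⟨r / 2, half_pos hr, fun k => (k + 1 : ℕ) * (dunklBound Rp κ * ‖a‖ * B (k + 1)),
    fun k => (hG (k + 1)).dunklAt Rp κ a, ?_, fun y hy => ?_⟩
  · have := ((summable_nat_add_iff 1).2 hu).mul_left (dunklBound Rp κ * ‖a‖)
    refine this.congr fun k => ?_
    rw [Nat.add_sub_cancel]
    ring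
  · have h1 : HasSum (fun k => DunklSlice.dunklAt Rp κ a (G k) y) (DunklSlice.dunklAt Rp κ a g y) :=
      ((hder y hy).mapL (ContinuousLinearMap.apply ℝ V a)).add
        (hasSum_sum fun α _ => (hrho α y hy).const_smul _)
    rw [← hasSum_nat_add_iff' 1] at h1
    simpa [(hG 0).dunklAt_eq_zero Rp κ a rfl] using h1

theorem HasHomExpansion.iterate_dunklAt [CompleteSpace V] (Rp : Finset (Vec m)) (κ : Vec m → ℝ)
    (a : Vec m) (n : ℕ) {g : Vec m → V} {G : ℕ → Vec m → V} (h : HasHomExpansion g G) :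
    HasHomExpansion ((DunklSlice.dunklAt Rp κ a)^[n] g)
      (fun k => (DunklSlice.dunklAt Rp κ a)^[n] (G (k + n))) := by
  induction n with
  | zero => exact h
  | succ n ih =>
    simp only [Function.iterate_succ_apply']
    have := ih.dunklAt Rp κ a
    simpa only [add_assoc, add_comm 1 n] using this

theorem HasHomExpansion.apply_zero {g : Vec m → V} {G : ℕ → Vec m → V}
    (h : HasHomExpansion g G) : g 0 = G 0 0 := by
  obtain ⟨r, hr, B, hG, hB, hsum⟩ := h
  refine (hsum 0 (by simpa using hr)).unique (hasSum_single 0 fun k hk => ?_)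
  have := (hG k).norm_le 0
  rw [norm_zero, zero_pow hk, mul_zero] at this
  exact norm_le_zero_iff.1 this

theorem HasHomExpansion.iterate_dunklAt_apply_zero [CompleteSpace V] (Rp : Finset (Vec m))
    (κ : Vec m → ℝ) (a : Vec m) (n : ℕ) {g : Vec m → V} {G : ℕ → Vec m → V}
    (h : HasHomExpansion g G) :
    (DunklSlice.dunklAt Rp κ a)^[n] g 0 = (DunklSlice.dunklAt Rp κ a)^[n] (G n) 0 := by
  simpa using (h.iterate_dunklAt Rp κ a n).apply_zero

end Expansions

section SliceRegular

variable {m : ℕ} {D : Set ℂ} {α β : ℂ → Cl m}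

/-! ### Taylor expansion of slice regular functions at real points -/

theorem differentiableOn_iteratedDeriv (hD : IsOpen D) {H : ℂ → ℂ} (hH : DifferentiableOn ℂ H D)
    (n : ℕ) : DifferentiableOn ℂ (iteratedDeriv n H) D := by
  induction n with
  | zero => simpa using hH
  | succ n ih => rw [iteratedDeriv_succ]; exact ih.deriv hD

/-- On the real axis `Im H` is the real part of `-iH`, so its real derivative is `Im H'`. -/
theorem im_deriv_ofReal_eq_zero (hD : IsOpen D) {H : ℂ → ℂ} (hH : DifferentiableOn ℂ H D)
    (h0 : ∀ t : ℝ, (t : ℂ) ∈ D → (H t).im = 0) {t : ℝ} (ht : (t : ℂ) ∈ D) :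
    (deriv H t).im = 0 := by
  have h1 : HasDerivAt (fun z => -Complex.I * H z) (-Complex.I * deriv H t) t :=
    ((hH.differentiableAt (hD.mem_nhds ht)).hasDerivAt).const_mul _
  have h2 := h1.real_of_complex
  simp only [neg_mul, Complex.neg_re, Complex.I_mul_re, neg_neg] at h2
  have h3 : (fun x : ℝ => (H x).im) =ᶠ[𝓝 t] fun _ => 0 := by
    filter_upwards [(hD.preimage Complex.continuous_ofReal).mem_nhds ht] with x hx
    exact h0 x hx
  exact (h2.congr_of_eventuallyEq h3.symm).unique (hasDerivAt_const t 0)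

theorem im_iteratedDeriv_ofReal_eq_zero (hD : IsOpen D) {H : ℂ → ℂ} (hH : DifferentiableOn ℂ H D)
    (h0 : ∀ t : ℝ, (t : ℂ) ∈ D → (H t).im = 0) (n : ℕ) {t : ℝ} (ht : (t : ℂ) ∈ D) :
    (iteratedDeriv n H t).im = 0 := by
  induction n generalizing t with
  | zero => simpa using h0 t ht
  | succ n ih =>
    rw [iteratedDeriv_succ]
    exact im_deriv_ofReal_eq_zero hD (differentiableOn_iteratedDeriv hD hH n) (fun s hs => ih hs) ht

/-- A coordinate of a stem function. -/
def stemCoord (α β : ℂ → Cl m) (i : Fin (Module.finrank ℝ (Cl m))) (z : ℂ) : ℂ :=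
  ((Module.finBasis ℝ (Cl m)).coord i (α z) : ℂ) +
    (Module.finBasis ℝ (Cl m)).coord i (β z) * Complex.I

theorem IsHolomorphicStem.differentiableOn_stemCoord (h : IsHolomorphicStem D α β)
    (i : Fin (Module.finrank ℝ (Cl m))) : DifferentiableOn ℂ (stemCoord α β i) D := by
  intro z hz
  refine DifferentiableAt.differentiableWithinAt ?_
  let ℓ : Cl m →L[ℝ] ℂ :=
    Complex.ofRealCLM.comp (((Module.finBasis ℝ (Cl m)).coord i).toContinuousLinearMap)
  let P : ℂ →L[ℝ] ℂ := ContinuousLinearMap.mul ℝ ℂ Complex.I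
  have h1 : HasFDerivAt (stemCoord α β i)
      (ℓ.comp (fderiv ℝ α z) + P.comp (ℓ.comp (fderiv ℝ β z))) z := by
    have ha := ℓ.hasFDerivAt.comp z (h.differentiableAt_fst z hz).hasFDerivAt
    have hb := P.hasFDerivAt.comp z (ℓ.hasFDerivAt.comp z (h.differentiableAt_snd z hz).hasFDerivAt)
    refine (ha.add hb).congr_of_eventuallyEq (Filter.Eventually.of_forall fun w => ?_)
    simp [stemCoord, ℓ, P, mul_comm]
  rw [differentiableAt_complex_iff_differentiableAt_real]
  refine ⟨h1.differentiableAt, ?_⟩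
  have e1 := h.cauchyRiemann_fst z hz
  have e2 := h.cauchyRiemann_snd z hz
  rw [h1.fderiv]
  simp only [add_apply, ContinuousLinearMap.comp_apply, e1, e2, map_neg, P,
    ContinuousLinearMap.mul_apply', smul_eq_mul]
  linear_combination (ℓ (fderiv ℝ β z 1)) * (-Complex.I_mul_I)

theorem IsHolomorphicStem.im_stemCoord_ofReal (h : IsHolomorphicStem D α β)
    (i : Fin (Module.finrank ℝ (Cl m))) {t : ℝ} (ht : (t : ℂ) ∈ D) :
    (stemCoord α β i t).im = 0 := by
  have h1 := h.odd t ht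
  rw [Complex.conj_ofReal, eq_neg_iff_add_eq_zero, ← two_nsmul] at h1
  have h2 : β t = 0 := by
    have h3 : (2 : ℝ) • β t = 0 := by rw [two_smul, ← two_nsmul]; exact h1
    exact (smul_eq_zero.1 h3).resolve_left two_ne_zero
  simp [stemCoord, h2]

/-- The Taylor coefficients of a slice regular function at a real point. -/
def taylorCoeff (α β : ℂ → Cl m) (n : ℕ) (t : ℝ) : Cl m :=
  ∑ i, ((n.factorial : ℝ)⁻¹ * (iteratedDeriv n (stemCoord α β i) t).re) •
    Module.finBasis ℝ (Cl m) i

theorem IsHolomorphicStem.hasDerivAt_taylorCoeff (hD : IsOpen D) (h : IsHolomorphicStem D α β)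
    (n : ℕ) {t : ℝ} (ht : (t : ℂ) ∈ D) :
    HasDerivAt (taylorCoeff α β n) (((n : ℝ) + 1) • taylorCoeff α β (n + 1) t) t := by
  have h1 : ((n : ℝ) + 1) • taylorCoeff α β (n + 1) t =
      ∑ i, ((n.factorial : ℝ)⁻¹ * (iteratedDeriv (n + 1) (stemCoord α β i) t).re) •
        Module.finBasis ℝ (Cl m) i := by
    rw [taylorCoeff, Finset.smul_sum]
    refine Finset.sum_congr rfl fun i _ => ?_
    rw [smul_smul, Nat.factorial_succ]
    congr 1
    have : (n.factorial : ℝ) ≠ 0 := by exact_mod_cast n.factorial_ne_zero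
    push_cast
    field_simp
  rw [h1]
  refine HasDerivAt.fun_sum fun i _ => ?_
  refine HasDerivAt.smul_const (HasDerivAt.const_mul _ ?_) _
  rw [iteratedDeriv_succ]
  exact ((differentiableOn_iteratedDeriv hD (h.differentiableOn_stemCoord i) n).differentiableAt
    (hD.mem_nhds ht)).hasDerivAt.real_of_complex

theorem IsHolomorphicStem.exists_taylorCoeff_bound (hD : IsOpen D) (h : IsHolomorphicStem D α β)
    {a : ℝ} (ha : (a : ℂ) ∈ D) :
    ∃ r > 0, ∃ M, ∀ t : ℝ, |t - a| < r →
      (t : ℂ) ∈ D ∧ ∀ n, ‖taylorCoeff α β n t‖ ≤ M * r⁻¹ ^ n := by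
  obtain ⟨ε, hε, hsub⟩ := Metric.isOpen_iff.1 hD a ha
  -- For `|t - a| < r` every disc of radius `r` about `t` lies in the single compact disc of radius
  -- `2r < ε` about `a`. This makes the Cauchy estimates uniform in `t`.
  set r := ε / 3 with hr
  have hr0 : 0 < r := by positivity
  have hball : ∀ t : ℝ, |t - a| < r →
      Metric.closedBall (t : ℂ) r ⊆ Metric.closedBall (a : ℂ) (2 * r) := by
    intro t ht
    refine Metric.closedBall_subset_closedBall' ?_
    rw [Complex.dist_eq, ← Complex.ofReal_sub, Complex.norm_real, Real.norm_eq_abs]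
    linarith
  have hbig : Metric.closedBall (a : ℂ) (2 * r) ⊆ D :=
    (Metric.closedBall_subset_ball (by rw [hr]; linarith)).trans hsub
  choose C hC using fun i => (isCompact_closedBall (a : ℂ) (2 * r)).exists_bound_of_continuousOn
    ((h.differentiableOn_stemCoord i).continuousOn.mono hbig)
  refine ⟨r, hr0, ∑ i, C i * ‖Module.finBasis ℝ (Cl m) i‖, fun t ht => ⟨?_, fun n => ?_⟩⟩
  · exact hbig (hball t ht (Metric.mem_closedBall_self hr0.le))
  · rw [taylorCoeff, Finset.sum_mul]
    refine (norm_sum_le _ _).trans (Finset.sum_le_sum fun i _ => ?_)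
    have hc := Complex.norm_iteratedDeriv_le_of_forall_mem_sphere_norm_le n hr0
      (((h.differentiableOn_stemCoord i).mono ((hball t ht).trans hbig)).diffContOnCl_ball le_rfl)
      (fun z hz => hC i z (hball t ht (Metric.sphere_subset_closedBall hz)))
    have hn : (0 : ℝ) < n.factorial := by exact_mod_cast n.factorial_pos
    rw [norm_smul, norm_mul, norm_inv, Real.norm_of_nonneg hn.le, Real.norm_eq_abs,
      mul_right_comm (C i)]
    refine mul_le_mul_of_nonneg_right ?_ (norm_nonneg _)
    rw [inv_mul_le_iff₀ hn, inv_pow, ← div_eq_mul_inv, ← mul_div_assoc]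
    exact (Complex.abs_re_le_norm _).trans hc

/-- For a unit vector `ω`, sending `i` to `vec ω` is a real algebra homomorphism from `ℂ` to the
Clifford algebra. It carries the complex Taylor series of each stem coordinate, with `z - t = i‖y‖`,
to a power series in `vec y`. -/
theorem IsHolomorphicStem.hasSum_taylorCoeff (hD : IsOpen D) (h : IsHolomorphicStem D α β)
    (hm : 0 < m) {f : ℝ × Vec m → Cl m}
    (hf : ∀ z ∈ D, ∀ ω : Vec m, ‖ω‖ = 1 → f (z.re, z.im • ω) = α z + vec ω * β z)
    {t r : ℝ} (hball : Metric.ball (t : ℂ) r ⊆ D) {y : Vec m} (hy : ‖y‖ < r) :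
    HasSum (fun n => vec y ^ n * taylorCoeff α β n t) (f (t, y)) := by
  obtain ⟨ω, hω, hyω⟩ : ∃ ω : Vec m, ‖ω‖ = 1 ∧ y = ‖y‖ • ω := by
    rcases eq_or_ne y 0 with rfl | hy0
    · exact ⟨stdVec ⟨0, hm⟩, norm_stdVec _, by simp⟩
    · exact ⟨‖y‖⁻¹ • y, norm_smul_inv_norm hy0, (smul_inv_smul₀ (norm_ne_zero_iff.2 hy0) y).symm⟩
  have hr0 : 0 < r := (norm_nonneg y).trans_lt hy
  have ht : (t : ℂ) ∈ D := hball (Metric.mem_ball_self hr0)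
  set z : ℂ := t + ‖y‖ * Complex.I with hz
  have hzre : z.re = t := by simp [hz]
  have hzim : z.im = ‖y‖ := by simp [hz]
  have hzb : z ∈ Metric.ball (t : ℂ) r := by
    rw [Metric.mem_ball, Complex.dist_eq, hz]
    simpa using hy
  have hωω : vec ω * vec ω = (-1 : Cl m) := by
    rw [vec_mul_self, hω]; simp
  let Ψ : ℂ →ₐ[ℝ] Cl m := Complex.liftAux (vec ω) hωω
  let ΨL : ℂ →L[ℝ] Cl m := Ψ.toLinearMap.toContinuousLinearMap
  have hΨL : ∀ w, ΨL w = Ψ w := fun w => rfl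
  have hΨz : Ψ (z - t) = vec y := by
    have h1 : vec y = ‖y‖ • vec ω := by
      conv_lhs => rw [hyω]
      exact (vecL m).map_smul _ _
    rw [h1]
    simp [Ψ, hz]
  let b := Module.finBasis ℝ (Cl m)
  have hfz : f (t, y) = ∑ i, Ψ (stemCoord α β i z) * b i := by
    have h1 := hf z (hball hzb) ω hω
    rw [hzre, hzim, ← hyω] at h1
    rw [h1]
    conv_lhs => rw [← b.sum_repr (α z), ← b.sum_repr (β z)]
    rw [Finset.mul_sum, ← Finset.sum_add_distrib]
    refine Finset.sum_congr rfl fun i _ => ?_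
    simp [Ψ, stemCoord, b, add_mul, Algebra.algebraMap_eq_smul_one]
  rw [hfz]
  simp only [taylorCoeff, Finset.mul_sum]
  refine hasSum_sum fun i _ => ?_
  have hs := Complex.hasSum_taylorSeries_on_ball
    ((h.differentiableOn_stemCoord i).mono hball) hzb
  have hs' := (hs.mapL ΨL).mapL ((mulL m).flip (b i))
  refine (show (fun n => vec y ^ n * (((n.factorial : ℝ)⁻¹ *
    (iteratedDeriv n (stemCoord α β i) t).re) • b i)) = _ from funext fun n => ?_) ▸ hs'
  symm
  -- The homomorphism is only real-linear; real Taylor coefficients can be pulled out as scalars, so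
  -- they do not depend on `ω`.
  have him := im_iteratedDeriv_ofReal_eq_zero hD (h.differentiableOn_stemCoord i)
    (fun s hs => h.im_stemCoord_ofReal i hs) n ht
  have hre : ((n.factorial : ℂ)⁻¹ • (z - t) ^ n • iteratedDeriv n (stemCoord α β i) t) =
      ((n.factorial : ℝ)⁻¹ * (iteratedDeriv n (stemCoord α β i) t).re) • (z - t) ^ n := by
    have : iteratedDeriv n (stemCoord α β i) t =
        ((iteratedDeriv n (stemCoord α β i) t).re : ℂ) := Complex.ext rfl (by simp [him])
    conv_lhs => rw [this]
    rw [Complex.real_smul]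
    push_cast
    simp only [smul_eq_mul]
    ring
  rw [hre, hΨL, map_smul, map_pow, hΨz, ContinuousLinearMap.flip_apply, mulL_apply,
    smul_mul_assoc, mul_smul_comm]

end SliceRegular

section Terms

variable {m : ℕ} {V : Type*} [NormedAddCommGroup V] [NormedSpace ℝ V]
  {R Rp : Finset (Vec m)} {κ : Vec m → ℝ} {D : Set ℂ} {α β : ℂ → Cl m}

/-! ### The terms of the exponential series -/

theorem IsHolomorphicStem.hasHomExpansion (hD : IsOpen D) (h : IsHolomorphicStem D α β)
    (hm : 0 < m) {f : ℝ × Vec m → Cl m}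
    (hf : ∀ z ∈ D, ∀ ω : Vec m, ‖ω‖ = 1 → f (z.re, z.im • ω) = α z + vec ω * β z)
    {t : ℝ} (ht : (t : ℂ) ∈ D) :
    HasHomExpansion (fun y => f (t, y)) (fun k y => vec y ^ k * taylorCoeff α β k t) := by
  obtain ⟨ε, hε, hball⟩ := Metric.isOpen_iff.1 hD t ht
  obtain ⟨r, hr, M, hM⟩ := h.exists_taylorCoeff_bound hD ht
  have hM := (hM t (by simpa using hr)).2
  have hq := genBound_nonneg m
  -- The second bound forces the ratio `genBound m * r⁻¹ * ρ` of the majorizing geometric series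
  -- below `1`; the `+ 1` avoids division by zero.
  set ρ := min ε (r / (2 * (genBound m + 1))) with hρ
  have hρ0 : 0 < ρ := lt_min hε (by positivity)
  refine ⟨ρ, hρ0, fun k => ‖(mulL m).flip‖ * (M * r⁻¹ ^ k) * (genBound m ^ k * ‖(1 : Cl m)‖),
    fun k => ?_, ?_, fun y hy => ?_⟩
  · refine ((homPoly_vec_pow m k).clm_comp ((mulL m).flip (taylorCoeff α β k t))).mono ?_
    refine mul_le_mul_of_nonneg_right (((mulL m).flip.le_opNorm _).trans ?_) (by positivity)
    exact mul_le_mul_of_nonneg_left (hM k) (norm_nonneg _)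
  · have h1 : genBound m * r⁻¹ * ρ < 1 := by
      have h2 : ρ ≤ r / (2 * (genBound m + 1)) := min_le_right _ _
      calc genBound m * r⁻¹ * ρ ≤ genBound m * r⁻¹ * (r / (2 * (genBound m + 1))) := by gcongr
        _ = genBound m / (2 * (genBound m + 1)) := by field_simp
        _ < 1 := by rw [div_lt_one (by positivity)]; linarith
    have h3 := (summable_geometric_of_lt_one (by positivity) h1).mul_left
      (‖(mulL m).flip‖ * M * ‖(1 : Cl m)‖)
    refine h3.congr fun k => ?_
    rw [mul_pow, mul_pow]
    ring
  · exact h.hasSum_taylorCoeff hD hm hf hball (hy.trans_le (min_le_left _ _))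

/-- The terms of the exponential series of the slice regular function with stem `α + iβ`. -/
def seriesTerm (Rp : Finset (Vec m)) (κ : Vec m → ℝ) (α β : ℂ → Cl m) (n : ℕ)
    (p : ℝ × Vec m) : Cl m :=
  dunklPow Rp κ n p.2 * taylorCoeff α β n p.1

theorem IsHolomorphicStem.expTerm_eq (hD : IsOpen D) (h : IsHolomorphicStem D α β)
    (hm : 0 < m) {f : ℝ × Vec m → Cl m}
    (hf : ∀ z ∈ D, ∀ ω : Vec m, ‖ω‖ = 1 → f (z.re, z.im • ω) = α z + vec ω * β z)
    (n : ℕ) {p : ℝ × Vec m} (hp : (p.1 : ℂ) ∈ D) :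
    expTerm Rp κ f n p = seriesTerm Rp κ α β n p := by
  have h1 := (h.hasHomExpansion hD hm hf hp).iterate_dunklAt_apply_zero Rp κ p.2 n
  have h2 := congrFun ((homPoly_vec_pow m n).iterate_dunklAt_clm_comp (Rp := Rp) (κ := κ) p.2 n
    ((mulL m).flip (taylorCoeff α β n p.1))) 0
  simp only [ContinuousLinearMap.flip_apply, mulL_apply] at h2
  rw [expTerm, dunklDir_eq_dunklAt, h1, h2, seriesTerm, dunklPow, smul_mul_assoc]

/-- The derivative of `seriesTerm`. -/
def seriesTermDeriv (Rp : Finset (Vec m)) (κ : Vec m → ℝ) (α β : ℂ → Cl m) (n : ℕ)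
    (p : ℝ × Vec m) : ℝ × Vec m →L[ℝ] Cl m :=
  (ContinuousLinearMap.fst ℝ ℝ (Vec m)).smulRight
      (((n : ℝ) + 1) • (dunklPow Rp κ n p.2 * taylorCoeff α β (n + 1) p.1)) +
    ((mulL m).flip (taylorCoeff α β n p.1)).comp
      ((fderiv ℝ (dunklPow Rp κ n) p.2).comp (ContinuousLinearMap.snd ℝ ℝ (Vec m)))

theorem contDiff_dunklPow (Rp : Finset (Vec m)) (κ : Vec m → ℝ) (n : ℕ) :
    ContDiff ℝ ⊤ (dunklPow Rp κ n) := by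
  obtain ⟨B, hB⟩ := exists_homPoly_dunklPow Rp κ n
  exact hB.contDiff

theorem differentiable_dunklPow (Rp : Finset (Vec m)) (κ : Vec m → ℝ) (n : ℕ) :
    Differentiable ℝ (dunklPow Rp κ n) :=
  (contDiff_dunklPow Rp κ n).differentiable (by simp)

theorem IsHolomorphicStem.hasFDerivAt_seriesTerm (hD : IsOpen D) (h : IsHolomorphicStem D α β)
    (n : ℕ) {p : ℝ × Vec m} (hp : (p.1 : ℂ) ∈ D) :
    HasFDerivAt (seriesTerm Rp κ α β n) (seriesTermDeriv Rp κ α β n p) p := by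
  have h1 := (differentiable_dunklPow Rp κ n p.2).hasFDerivAt.comp p
    (hasFDerivAt_snd (𝕜 := ℝ) (p := p))
  have h2 := (h.hasDerivAt_taylorCoeff hD n hp).hasFDerivAt.comp p
    (hasFDerivAt_fst (𝕜 := ℝ) (p := p))
  refine ((mulL m).hasFDerivAt_of_bilinear h1 h2).congr_fderiv ?_
  ext v
  · simp [seriesTermDeriv]
  · simp [seriesTermDeriv]

theorem IsHolomorphicStem.continuousOn_seriesTermDeriv (hD : IsOpen D)
    (h : IsHolomorphicStem D α β) (n : ℕ) :
    ContinuousOn (seriesTermDeriv Rp κ α β n) {p | (p.1 : ℂ) ∈ D} := by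
  have hc : ∀ k, ContinuousOn (fun p : ℝ × Vec m => taylorCoeff α β k p.1) {p | (p.1 : ℂ) ∈ D} :=
    fun k p hp => ((h.hasDerivAt_taylorCoeff hD k hp).continuousAt.comp
      continuousAt_fst).continuousWithinAt
  have hd : Continuous fun p : ℝ × Vec m => dunklPow Rp κ n p.2 :=
    (differentiable_dunklPow Rp κ n).continuous.comp continuous_snd
  have hd' : Continuous fun p : ℝ × Vec m => fderiv ℝ (dunklPow Rp κ n) p.2 :=
    ((contDiff_dunklPow Rp κ n).continuous_fderiv (by simp)).comp continuous_snd
  refine ContinuousOn.add ?_ ?_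
  · have h1 : ContinuousOn (fun p : ℝ × Vec m => ((n : ℝ) + 1) •
        mulL m (dunklPow Rp κ n p.2) (taylorCoeff α β (n + 1) p.1)) {p | (p.1 : ℂ) ∈ D} :=
      (((mulL m).continuous.comp hd).continuousOn.clm_apply (hc (n + 1))).const_smul ((n : ℝ) + 1)
    exact ((ContinuousLinearMap.smulRightL ℝ (ℝ × Vec m) (Cl m)
      (ContinuousLinearMap.fst ℝ ℝ (Vec m))).continuous.comp_continuousOn h1)
  · exact ((mulL m).flip.continuous.comp_continuousOn (hc n)).clm_comp
      (hd'.continuousOn.clm_comp continuousOn_const)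

/-! ### Markov's inequality -/

theorem HomPoly.exists_polynomial {k : ℕ} {B : ℝ} {g : Vec m → ℝ} (hg : HomPoly k B g)
    (x v : Vec m) :
    ∃ P : Polynomial ℝ, P.natDegree ≤ k ∧ ∀ s : ℝ, P.eval s = g (x + s • v) := by
  induction hg with
  | const c => exact ⟨Polynomial.C c, by simp, by simp⟩
  | zero k => exact ⟨0, by simp, by simp⟩
  | add _ _ h1 h2 =>
    obtain ⟨P, hP, hP'⟩ := h1
    obtain ⟨Q, hQ, hQ'⟩ := h2
    exact ⟨P + Q, (Polynomial.natDegree_add_le _ _).trans (max_le hP hQ), by simp [hP', hQ']⟩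
  | mul a _ ih =>
    obtain ⟨P, hP, hP'⟩ := ih
    refine ⟨(Polynomial.C (inner ℝ a v) * Polynomial.X + Polynomial.C (inner ℝ a x)) * P, ?_, ?_⟩
    · refine Polynomial.natDegree_mul_le.trans ?_
      have := Polynomial.natDegree_linear_le (a := (inner ℝ a v : ℝ)) (b := inner ℝ a x)
      omega
    · intro s
      simp [hP', inner_add_right, inner_smul_right]
      ring_nf
      simp
  | mono _ _ ih => exact ih

/-- Composed with a norming functional and restricted to a segment, `g` becomes a real polynomial of
degree at most `k`. The Chebyshev polynomial is extremal for the derivative at the endpoint `1`, and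
its derivative there is `k²`. -/
theorem HomPoly.norm_fderiv_le_of_bound {k : ℕ} {B : ℝ} {g : Vec m → V} (hg : HomPoly k B g)
    {x : Vec m} {δ M : ℝ} (hδ : 0 < δ) (hM0 : 0 < M) (hM : ∀ z, ‖z - x‖ ≤ δ → ‖g z‖ ≤ M) :
    ‖fderiv ℝ g x‖ ≤ 2 * k ^ 2 * M / δ := by
  have key : ∀ w : Vec m, 2 * ‖w‖ ≤ δ → ‖fderiv ℝ g x w‖ ≤ k ^ 2 * M := by
    intro w hw
    obtain ⟨φ, hφ, hφw⟩ := exists_dual_vector'' ℝ (fderiv ℝ g x w)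
    -- Centring the segment at `x - w` puts `x` at the endpoint `s = 1`; the segment stays within
    -- `2‖w‖ ≤ δ` of `x`.
    obtain ⟨P, hP, hPe⟩ := (hg.clm_comp φ).exists_polynomial (x - w) w
    have hbd : ∀ s ∈ Set.Icc (-1 : ℝ) 1, |(Polynomial.C M⁻¹ * P).eval s| ≤ 1 := by
      intro s hs
      rw [Polynomial.eval_mul, Polynomial.eval_C, hPe, abs_mul, abs_inv, abs_of_pos hM0,
        inv_mul_le_iff₀ hM0, mul_one, ← Real.norm_eq_abs]
      refine (φ.le_of_opNorm_le hφ _).trans ?_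
      rw [one_mul]
      refine hM _ ?_
      rw [show x - w + s • w - x = (s - 1) • w by module, norm_smul, Real.norm_eq_abs]
      have : |s - 1| ≤ 2 := abs_le.2 ⟨by linarith [hs.1], by linarith [hs.2]⟩
      exact (mul_le_mul_of_nonneg_right this (norm_nonneg _)).trans hw
    have hmk := Polynomial.Chebyshev.eval_iterate_derivative_le_of_forall_abs_le_one (n := k)
      (k := 1) (x := 1) le_rfl (Polynomial.degree_le_of_natDegree_le
        ((Polynomial.natDegree_C_mul_le _ _).trans hP)) hbd
    simp only [Function.iterate_one, Polynomial.Chebyshev.derivative_T_eval_one,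
      Polynomial.derivative_C_mul, Polynomial.eval_mul, Polynomial.eval_C] at hmk
    rw [inv_mul_le_iff₀ hM0] at hmk
    have hder : P.derivative.eval 1 = φ (fderiv ℝ g x w) := by
      have h1 := P.hasDerivAt (1 : ℝ)
      have h2 : HasDerivAt (fun s : ℝ => x - w + s • w) w 1 := by
        simpa using ((hasDerivAt_id (1 : ℝ)).smul_const w).const_add (x - w)
      have h3 : HasFDerivAt g (fderiv ℝ g x) (x - w + (1 : ℝ) • w) := by
        rw [one_smul, sub_add_cancel]
        exact (hg.differentiable x).hasFDerivAt
      have h4 := φ.hasFDerivAt.comp_hasDerivAt (1 : ℝ) (h3.comp_hasDerivAt (1 : ℝ) h2)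
      refine h1.unique (h4.congr_of_eventuallyEq (Filter.Eventually.of_forall fun s => ?_))
      exact hPe s
    rw [hder, hφw] at hmk
    simpa [mul_comm] using hmk
  refine ContinuousLinearMap.opNorm_le_bound _ (by positivity) fun v => ?_
  rcases eq_or_ne v 0 with rfl | hv
  · simp
  · have hv0 : 0 < ‖v‖ := norm_pos_iff.2 hv
    have h1 := key ((δ / (2 * ‖v‖)) • v) (by
      rw [norm_smul, Real.norm_of_nonneg (by positivity)]
      field_simp
      exact le_rfl)
    rw [map_smul, norm_smul, Real.norm_of_nonneg (by positivity), div_mul_eq_mul_div,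
      div_le_iff₀ (by positivity)] at h1
    rw [div_mul_eq_mul_div, le_div_iff₀ hδ]
    linarith

end Terms

section Monogenic

variable {m : ℕ} {R Rp : Finset (Vec m)} {κ : Vec m → ℝ} {D : Set ℂ} {α β : ℂ → Cl m}

/-! ### Monogenicity of the sum -/

theorem HomPoly.map_smul {V : Type*} [NormedAddCommGroup V] [NormedSpace ℝ V] {k : ℕ} {B : ℝ}
    {g : Vec m → V} (hg : HomPoly k B g) (c : ℝ) (y : Vec m) : g (c • y) = c ^ k • g y := by
  induction hg with
  | const c => simp
  | zero k => simp
  | add _ _ h1 h2 => simp [h1, h2]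
  | mul a _ ih =>
    simp only [ih]
    rw [inner_smul_right, smul_smul, smul_smul, pow_succ]
    congr 1
    ring
  | mono _ _ ih => exact ih

/-- The generalized Cauchy-Riemann operator on derivatives. -/
def cauchyRiemannL (m : ℕ) : (ℝ × Vec m →L[ℝ] Cl m) →L[ℝ] Cl m :=
  ContinuousLinearMap.apply ℝ (Cl m) ((1, 0) : ℝ × Vec m) +
    ∑ j : Fin m, (mulL m (e j)).comp
      (ContinuousLinearMap.apply ℝ (Cl m) ((0, stdVec j) : ℝ × Vec m))

theorem cauchyRiemannL_apply (A : ℝ × Vec m →L[ℝ] Cl m) :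
    cauchyRiemannL m A = A (1, 0) + ∑ j : Fin m, e j * A (0, stdVec j) := by
  simp [cauchyRiemannL]

theorem cauchyRiemannL_seriesTermDeriv (hR : IsRootSystem R) (hRp : IsPositiveSubsystem R Rp)
    (hκ : IsMultiplicity R κ) (hγ : index Rp κ = (1 - (m : ℝ)) / 2) (n : ℕ) (p : ℝ × Vec m) :
    cauchyRiemannL m (seriesTermDeriv Rp κ α β n p) =
      ((n : ℝ) + 1) • (dunklPow Rp κ n p.2 * taylorCoeff α β (n + 1) p.1) -
      (n : ℝ) • (dunklPow Rp κ (n - 1) p.2 * taylorCoeff α β n p.1) := by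
  have h := dirac_dunklPow hR hRp hκ hγ n p.2
  rw [cauchyRiemannL_apply]
  simp only [seriesTermDeriv, add_apply, ContinuousLinearMap.smulRight_apply,
    ContinuousLinearMap.comp_apply, ContinuousLinearMap.coe_fst', ContinuousLinearMap.coe_snd',
    map_zero, one_smul, zero_smul, zero_add, add_zero, ContinuousLinearMap.flip_apply, mulL_apply,
    ← mul_assoc]
  rw [← Finset.sum_mul, h, sub_eq_add_neg, neg_smul, neg_mul, smul_mul_assoc]

theorem seriesTermDeriv_fst (n : ℕ) (p : ℝ × Vec m) :
    seriesTermDeriv Rp κ α β n p (1, 0) =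
      ((n : ℝ) + 1) • (dunklPow Rp κ n p.2 * taylorCoeff α β (n + 1) p.1) := by
  simp [seriesTermDeriv]

/-- If the derivatives are summable at a point, then the Cauchy-Riemann operator annihilates
their sum: the series telescopes. -/
theorem cauchyRiemannL_eq_zero (hR : IsRootSystem R) (hRp : IsPositiveSubsystem R Rp)
    (hκ : IsMultiplicity R κ) (hγ : index Rp κ = (1 - (m : ℝ)) / 2) {p : ℝ × Vec m}
    {A : ℝ × Vec m →L[ℝ] Cl m} (hA : HasSum (fun n => seriesTermDeriv Rp κ α β n p) A) :
    cauchyRiemannL m A = 0 := by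
  have h1 := (hA.mapL (cauchyRiemannL m)).tendsto_sum_nat
  have h2 : ∀ N : ℕ, ∑ n ∈ Finset.range N, cauchyRiemannL m (seriesTermDeriv Rp κ α β n p) =
      (N : ℝ) • (dunklPow Rp κ (N - 1) p.2 * taylorCoeff α β N p.1) := by
    intro N
    induction N with
    | zero => simp
    | succ N ih =>
      rw [Finset.sum_range_succ, ih, cauchyRiemannL_seriesTermDeriv hR hRp hκ hγ]
      simp
  simp only [h2] at h1
  have h3 : Filter.Tendsto (fun n => seriesTermDeriv Rp κ α β n p (1, 0)) Filter.atTop (𝓝 0) :=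
    (hA.mapL (ContinuousLinearMap.apply ℝ (Cl m) ((1, 0) : ℝ × Vec m))).summable.tendsto_atTop_zero
  -- The telescoped partial sum up to `n + 1` is exactly the `x₀`-derivative of the `n`-th term,
  -- which tends to zero by summability.
  refine tendsto_nhds_unique (h1.comp (Filter.tendsto_add_atTop_nat 1)) (h3.congr fun n => ?_)
  simp [seriesTermDeriv_fst]

/-- The `x`-derivative is bounded by Markov's inequality. The `x₀`-derivative `(n + 1) Pₙ aₙ₊₁` is
minus the Dirac derivative of the term of index `n + 1`, so Markov's inequality bounds it as well.
Bounds on the terms at the fixed value `p.1` suffice. -/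
theorem norm_seriesTermDeriv_le (hR : IsRootSystem R) (hRp : IsPositiveSubsystem R Rp)
    (hκ : IsMultiplicity R κ) (hγ : index Rp κ = (1 - (m : ℝ)) / 2) (n : ℕ) (p : ℝ × Vec m)
    {δ C C' : ℝ} (hδ : 0 < δ) (hC : 0 < C) (hC' : 0 < C')
    (h : ∀ z, ‖z - p.2‖ ≤ δ → ‖seriesTerm Rp κ α β n (p.1, z)‖ ≤ C)
    (h' : ∀ z, ‖z - p.2‖ ≤ δ → ‖seriesTerm Rp κ α β (n + 1) (p.1, z)‖ ≤ C') :
    ‖seriesTermDeriv Rp κ α β n p‖ ≤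
      genBound m * (2 * (n + 1 : ℕ) ^ 2 * C' / δ) + 2 * n ^ 2 * C / δ := by
  have hpoly : ∀ k, ∃ B, HomPoly k B
      (fun z => (mulL m).flip (taylorCoeff α β k p.1) (dunklPow Rp κ k z)) := fun k =>
    let ⟨B, hB⟩ := exists_homPoly_dunklPow Rp κ k
    ⟨_, hB.clm_comp _⟩
  have hfd : ∀ k x, fderiv ℝ (fun z => (mulL m).flip (taylorCoeff α β k p.1)
      (dunklPow Rp κ k z)) x =
      ((mulL m).flip (taylorCoeff α β k p.1)).comp (fderiv ℝ (dunklPow Rp κ k) x) := fun k x =>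
    (((mulL m).flip (taylorCoeff α β k p.1)).hasFDerivAt.comp x
      (differentiable_dunklPow Rp κ k x).hasFDerivAt).fderiv
  obtain ⟨B, hB⟩ := hpoly n
  obtain ⟨B', hB'⟩ := hpoly (n + 1)
  have h1 := hB.norm_fderiv_le_of_bound hδ hC h
  have h1' := hB'.norm_fderiv_le_of_bound hδ hC' h'
  rw [hfd] at h1 h1'
  refine (norm_add_le _ _).trans (add_le_add ?_ ?_)
  · have h2 : ((n : ℝ) + 1) • (dunklPow Rp κ n p.2 * taylorCoeff α β (n + 1) p.1) =
        -∑ j : Fin m, mulL m (e j) (((mulL m).flip (taylorCoeff α β (n + 1) p.1)).comp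
          (fderiv ℝ (dunklPow Rp κ (n + 1)) p.2) (stdVec j)) := by
      have h3 := dirac_dunklPow hR hRp hκ hγ (n + 1) p.2
      simp only [ContinuousLinearMap.comp_apply, ContinuousLinearMap.flip_apply, mulL_apply,
        ← mul_assoc]
      rw [← Finset.sum_mul, h3, Nat.add_sub_cancel, neg_smul, neg_mul, neg_neg, smul_mul_assoc]
      push_cast
      rfl
    rw [ContinuousLinearMap.norm_smulRight_apply]
    refine (mul_le_of_le_one_left (norm_nonneg _) (ContinuousLinearMap.norm_fst_le ..)).trans ?_
    rw [h2, norm_neg, genBound, Finset.sum_mul]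
    refine (norm_sum_le _ _).trans (Finset.sum_le_sum fun j _ => ?_)
    refine ((mulL m (e j)).le_opNorm _).trans ?_
    gcongr
    refine (ContinuousLinearMap.le_opNorm _ _).trans ?_
    rw [norm_stdVec, mul_one]
    exact h1'
  · rw [← ContinuousLinearMap.comp_assoc]
    refine (ContinuousLinearMap.opNorm_comp_le _ _).trans ?_
    refine (mul_le_of_le_one_right (norm_nonneg _) (ContinuousLinearMap.norm_snd_le ..)).trans h1

/-! ### Termwise calculus for series whose terms are dominated only from some index on. -/

theorem summable_succ_sq_mul_geometric {τ : ℝ} (h0 : 0 ≤ τ) (h1 : τ < 1) (a b : ℝ) :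
    Summable fun n : ℕ => a * ((n + 1 : ℕ) ^ 2 * τ ^ (n + 1)) + b * (n ^ 2 * τ ^ n) := by
  have h := summable_pow_mul_geometric_of_norm_lt_one (R := ℝ) 2
    (by rwa [Real.norm_of_nonneg h0] : ‖τ‖ < 1)
  exact (((summable_nat_add_iff 1).2 h).mul_left a).add (h.mul_left b)

theorem continuousOn_tsum_of_norm_le_of_ge {X F : Type*} [TopologicalSpace X]
    [NormedAddCommGroup F] [CompleteSpace F] {f : ℕ → X → F} {u : ℕ → ℝ} {s : Set X} {N : ℕ}
    (hu : Summable u) (hf : ∀ n, ContinuousOn (f n) s) (hle : ∀ n, N ≤ n → ∀ x ∈ s, ‖f n x‖ ≤ u n) :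
    ContinuousOn (fun x => ∑' n, f n x) s := by
  have hut : Summable fun n => u (n + N) := (summable_nat_add_iff N).2 hu
  have hle' : ∀ n, ∀ x ∈ s, ‖f (n + N) x‖ ≤ u (n + N) := fun n => hle _ (by omega)
  have h1 : ContinuousOn (fun x => ∑ n ∈ Finset.range N, f n x + ∑' n, f (n + N) x) s :=
    (continuousOn_finsetSum _ fun n _ => hf n).add (continuousOn_tsum (fun n => hf _) hut hle')
  refine h1.congr fun x hx => (Summable.sum_add_tsum_nat_add N ?_).symm
  exact (summable_nat_add_iff N).1 (Summable.of_norm_bounded hut fun n => hle' n x hx)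

theorem hasFDerivAt_tsum_of_norm_le_of_ge {E F : Type*} [NormedAddCommGroup E] [NormedSpace ℝ E]
    [NormedAddCommGroup F] [NormedSpace ℝ F] [CompleteSpace F] {f : ℕ → E → F}
    {f' : ℕ → E → E →L[ℝ] F} {u : ℕ → ℝ} {s : Set E} {N : ℕ} (hu : Summable u) (hs : IsOpen s)
    (hs' : IsPreconnected s) (hf : ∀ n, ∀ x ∈ s, HasFDerivAt (f n) (f' n x) x)
    (hle : ∀ n, N ≤ n → ∀ x ∈ s, ‖f' n x‖ ≤ u n) (hsum : ∀ x ∈ s, Summable fun n => f n x)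
    {x : E} (hx : x ∈ s) : HasFDerivAt (fun x => ∑' n, f n x) (∑' n, f' n x) x := by
  have hut : Summable fun n => u (n + N) := (summable_nat_add_iff N).2 hu
  have hle' : ∀ n, ∀ x ∈ s, ‖f' (n + N) x‖ ≤ u (n + N) := fun n => hle _ (by omega)
  have hsum' : Summable fun n => f' n x :=
    (summable_nat_add_iff N).1 (Summable.of_norm_bounded hut fun n => hle' n x hx)
  have h1 : HasFDerivAt (fun x => ∑ n ∈ Finset.range N, f n x + ∑' n, f (n + N) x)
      (∑ n ∈ Finset.range N, f' n x + ∑' n, f' (n + N) x) x :=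
    (HasFDerivAt.fun_sum fun n _ => hf n x hx).add
      (hasFDerivAt_tsum_of_isPreconnected hut hs hs' (fun n => hf (n + N)) hle' hx
        ((summable_nat_add_iff N).2 (hsum x hx)) hx)
  rw [hsum'.sum_add_tsum_nat_add N] at h1
  refine h1.congr_of_eventuallyEq ?_
  filter_upwards [hs.mem_nhds hx] with y hy
  exact ((hsum y hy).sum_add_tsum_nat_add N).symm

/-- If the terms of the series decay geometrically on a neighbourhood, then the sum is
continuously differentiable and monogenic on a smaller one. -/
theorem exists_hasFDerivAt_tsum_seriesTerm (hR : IsRootSystem R) (hRp : IsPositiveSubsystem R Rp)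
    (hκ : IsMultiplicity R κ) (hγ : index Rp κ = (1 - (m : ℝ)) / 2) (hD : IsOpen D)
    (h : IsHolomorphicStem D α β) {p₀ : ℝ × Vec m} {τ : ℝ} (hτ0 : 0 < τ) (hτ : τ < 1) {N : ℕ}
    (hbd : ∀ᶠ p in 𝓝 p₀, (p.1 : ℂ) ∈ D ∧
      ∀ n, N ≤ n → ‖seriesTerm Rp κ α β n p‖ ≤ τ ^ n) :
    ∃ s ∈ 𝓝 p₀, ∃ G : ℝ × Vec m → ℝ × Vec m →L[ℝ] Cl m, ContinuousOn G s ∧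
      ∀ p ∈ s, HasFDerivAt (fun p => ∑' n, seriesTerm Rp κ α β n p) (G p) p ∧
        cauchyRiemannL m (G p) = 0 := by
  obtain ⟨ε, hε, hball⟩ := Metric.eventually_nhds_iff_ball.1 hbd
  -- Markov's inequality at a point of the ball of radius `δ` uses values up to distance `δ` from
  -- it, all within `ε` of `p₀`.
  set δ := ε / 2 with hδ
  have hδ0 : 0 < δ := half_pos hε
  have hsub : Metric.ball p₀ δ ⊆ Metric.ball p₀ ε := Metric.ball_subset_ball (by linarith)
  set u : ℕ → ℝ := fun n => genBound m * (2 * (n + 1 : ℕ) ^ 2 * τ ^ (n + 1) / δ) +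
    2 * n ^ 2 * τ ^ n / δ with hu_def
  have hu : Summable u := by
    refine (summable_succ_sq_mul_geometric hτ0.le hτ (genBound m * 2 / δ) (2 / δ)).congr fun n => ?_
    simp only [hu_def]
    ring
  have hder : ∀ n p, p ∈ Metric.ball p₀ δ →
      HasFDerivAt (seriesTerm Rp κ α β n) (seriesTermDeriv Rp κ α β n p) p := fun n p hp =>
    h.hasFDerivAt_seriesTerm hD n (hball p (hsub hp)).1
  have hle : ∀ n, N ≤ n → ∀ p ∈ Metric.ball p₀ δ, ‖seriesTermDeriv Rp κ α β n p‖ ≤ u n := by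
    intro n hn p hp
    have hz : ∀ z, ‖z - p.2‖ ≤ δ → (p.1, z) ∈ Metric.ball p₀ ε := by
      intro z hz
      have h1 : dist ((p.1, z) : ℝ × Vec m) p ≤ δ := by
        rw [Prod.dist_eq, dist_self, dist_eq_norm]
        exact max_le hδ0.le hz
      have h2 := dist_triangle ((p.1, z) : ℝ × Vec m) p p₀
      rw [Metric.mem_ball] at hp ⊢
      linarith
    exact norm_seriesTermDeriv_le hR hRp hκ hγ n p hδ0 (by positivity) (by positivity)
      (fun z hz' => (hball _ (hz z hz')).2 n hn)
      (fun z hz' => (hball _ (hz z hz')).2 (n + 1) (by omega))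
  have hut : Summable fun n => u (n + N) := (summable_nat_add_iff N).2 hu
  have hsumm : ∀ p ∈ Metric.ball p₀ δ, Summable fun n => seriesTerm Rp κ α β n p := by
    intro p hp
    rw [← summable_nat_add_iff N]
    refine Summable.of_norm_bounded ((summable_nat_add_iff N).2
      (summable_geometric_of_lt_one hτ0.le hτ)) fun n => ?_
    exact (hball p (hsub hp)).2 _ (by omega)
  have hsumm' : ∀ p ∈ Metric.ball p₀ δ, Summable fun n => seriesTermDeriv Rp κ α β n p := by
    intro p hp
    rw [← summable_nat_add_iff N]
    exact Summable.of_norm_bounded hut fun n => hle _ (by omega) p hp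
  have hcont : ∀ n, ContinuousOn (seriesTermDeriv Rp κ α β n) (Metric.ball p₀ δ) := fun n =>
    (h.continuousOn_seriesTermDeriv hD n).mono fun p hp => (hball p (hsub hp)).1
  have hmem : Metric.ball p₀ δ ∈ 𝓝 p₀ := Metric.ball_mem_nhds _ hδ0
  refine ⟨Metric.ball p₀ δ, hmem, fun p => ∑' n, seriesTermDeriv Rp κ α β n p, ?_,
    fun p hp => ⟨?_, ?_⟩⟩
  · exact continuousOn_tsum_of_norm_le_of_ge hu hcont hle
  · exact hasFDerivAt_tsum_of_norm_le_of_ge hu Metric.isOpen_ball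
      (convex_ball _ _).isPreconnected hder hle hsumm hp
  · exact cauchyRiemannL_eq_zero hR hRp hκ hγ (hsumm' p hp).hasSum

/-- Locally uniform boundedness of the terms forces geometric decay, by homogeneity in `x`. -/
theorem eventually_norm_seriesTerm_le {U : Set (ℝ × Vec m)} (hU : IsOpen U)
    (hbd : ∀ p ∈ U, ∃ N, ∀ᶠ q in 𝓝 p, ∀ n, N ≤ n → ‖seriesTerm Rp κ α β n q‖ ≤ 1)
    {p₀ : ℝ × Vec m} (hp₀ : p₀ ∈ U) :
    ∃ τ, 0 < τ ∧ τ < 1 ∧ ∃ N, ∀ᶠ p in 𝓝 p₀, ∀ n, N ≤ n → ‖seriesTerm Rp κ α β n p‖ ≤ τ ^ n := by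
  have hc : ∀ c : ℝ, Continuous fun p : ℝ × Vec m => (p.1, c • p.2) := fun c => by fun_prop
  have hc' : Continuous fun c : ℝ => (p₀.1, c • p₀.2) := by fun_prop
  have h1 : ∀ᶠ c in 𝓝 (1 : ℝ), (p₀.1, c • p₀.2) ∈ U :=
    hc'.continuousAt.eventually_mem (hU.mem_nhds (by simpa using hp₀))
  -- The dilated point still lies in the open set `U` for some `c > 1`. There the `n`-th term is
  -- multiplied by `cⁿ` yet eventually bounded by `1`, so `τ = c⁻¹` works.
  obtain ⟨c, hcU, hc1⟩ := ((h1.filter_mono nhdsWithin_le_nhds).and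
    (self_mem_nhdsWithin (s := Set.Ioi (1 : ℝ)))).exists
  have hc1 : 1 < c := hc1
  obtain ⟨N, hN⟩ := hbd _ hcU
  refine ⟨c⁻¹, by positivity, inv_lt_one_of_one_lt₀ hc1, N, ?_⟩
  filter_upwards [(hc c).continuousAt.eventually hN] with p hp n hn
  obtain ⟨B, hB⟩ := exists_homPoly_dunklPow Rp κ n
  have h2 := hp n hn
  rw [seriesTerm, hB.map_smul, smul_mul_assoc, norm_smul, norm_pow,
    Real.norm_of_nonneg (by positivity)] at h2
  rw [inv_pow, ← one_div, le_div_iff₀ (by positivity), mul_comm]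
  exact h2

/-- The growth `(q‖x‖)ⁿ` of the polynomials beats the Cauchy bound `r⁻ⁿ` of the coefficients once
`q‖x‖/r < 1/2`, which holds near `x = 0`. -/
theorem IsHolomorphicStem.eventually_norm_seriesTerm_le_real (hD : IsOpen D)
    (h : IsHolomorphicStem D α β) {a : ℝ} (ha : (a : ℂ) ∈ D) :
    ∃ M, ∀ᶠ p in 𝓝 ((a, 0) : ℝ × Vec m), (p.1 : ℂ) ∈ D ∧
      ∀ n, ‖seriesTerm Rp κ α β n p‖ ≤ M * (1 / 2) ^ n := by
  obtain ⟨r, hr, M, hM⟩ := h.exists_taylorCoeff_bound hD ha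
  set q := dunklBound Rp κ * genBound m with hq_def
  have hq : 0 ≤ q := mul_nonneg (dunklBound_pos Rp κ).le (genBound_nonneg m)
  refine ⟨‖mulL m‖ * ‖(1 : Cl m)‖ * M, ?_⟩
  have h1 : ∀ᶠ p in 𝓝 ((a, 0) : ℝ × Vec m), |p.1 - a| < r :=
    (continuous_fst.continuousAt (x := ((a, 0) : ℝ × Vec m))).eventually
      (Metric.ball_mem_nhds a hr)
  have h2 : ∀ᶠ p in 𝓝 ((a, 0) : ℝ × Vec m), q * ‖p.2‖ * r⁻¹ < 1 / 2 := by
    have : Continuous fun p : ℝ × Vec m => q * ‖p.2‖ * r⁻¹ := by fun_prop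
    exact this.continuousAt.eventually_lt continuousAt_const (by simp)
  filter_upwards [h1, h2] with p hp1 hp2
  obtain ⟨hpD, hp⟩ := hM p.1 hp1
  refine ⟨hpD, fun n => ?_⟩
  have hM0 : 0 ≤ M := by simpa using (norm_nonneg _).trans (hp 0)
  calc ‖seriesTerm Rp κ α β n p‖ ≤ ‖mulL m‖ * ‖dunklPow Rp κ n p.2‖ * ‖taylorCoeff α β n p.1‖ :=
        (mulL m).le_opNorm₂ _ _
    _ ≤ ‖mulL m‖ * ((q * ‖p.2‖) ^ n * ‖(1 : Cl m)‖) * (M * r⁻¹ ^ n) := by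
        gcongr
        · exact norm_dunklPow_le Rp κ n p.2
        · exact hp n
    _ = ‖mulL m‖ * ‖(1 : Cl m)‖ * M * (q * ‖p.2‖ * r⁻¹) ^ n := by rw [mul_pow]; ring
    _ ≤ _ := by gcongr

end Monogenic

end DunklSlice

end

/-! ### Convergence near the real points and monogenicity of the sum. -/

theorem theorem5 (m : ℕ) (R Rp : Finset (DunklSlice.Vec m)) (hR : DunklSlice.IsRootSystem R)
    (hRp : DunklSlice.IsPositiveSubsystem R Rp)
    (κ : DunklSlice.Vec m → ℝ) (hκ : DunklSlice.IsMultiplicity R κ)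
    (hγ : DunklSlice.index Rp κ = (1 - (m : ℝ)) / 2)
    (hsing : κ ∉ DunklSlice.singularSet R Rp)
    (D : Set ℂ) (hD : IsOpen D) (hDsymm : ∀ z ∈ D, conj z ∈ D)
    (f : ℝ × DunklSlice.Vec m → DunklSlice.Cl m) (hf : DunklSlice.IsSliceRegularOn D f) :
    (∃ U : Set (ℝ × DunklSlice.Vec m), IsOpen U ∧ (∀ x ∈ U, (x.1 : ℂ) ∈ D) ∧
      (∀ a : ℝ, (a : ℂ) ∈ D → (a, 0) ∈ U) ∧
      (∀ x ∈ U, Summable fun n => ‖DunklSlice.expTerm Rp κ f n x‖) ∧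
      TendstoLocallyUniformlyOn (DunklSlice.expPartial Rp κ f)
        (DunklSlice.invIntertwine Rp κ f) Filter.atTop U) ∧
    ∀ U : Set (ℝ × DunklSlice.Vec m), IsOpen U → (∀ x ∈ U, (x.1 : ℂ) ∈ D) →
      TendstoLocallyUniformlyOn (DunklSlice.expPartial Rp κ f)
        (DunklSlice.invIntertwine Rp κ f) Filter.atTop U →
      DunklSlice.IsMonogenicOn (DunklSlice.invIntertwine Rp κ f) U := by
  open DunklSlice in
  obtain ⟨α, β, hst, hfs⟩ := hf
  -- In dimension zero there are no roots, so the index would be `0` rather than `1/2`. Positivity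
  -- supplies a unit vector for the point `y = 0`.
  have hm : 0 < m := by
    rcases Nat.eq_zero_or_pos m with rfl | hm
    · exfalso
      have h1 : Rp = ∅ := by
        obtain ⟨v, -, hmem⟩ := hRp
        refine Finset.eq_empty_of_forall_notMem fun α hα => hR.zero_notMem ?_
        rw [Subsingleton.elim 0 α]
        exact ((hmem α).1 hα).1
      rw [h1] at hγ
      simp [index] at hγ
    · exact hm
  have hterm : ∀ n (p : ℝ × Vec m), (p.1 : ℂ) ∈ D →
      expTerm Rp κ f n p = seriesTerm Rp κ α β n p :=
    fun n p hp => hst.expTerm_eq hD hm hfs n hp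
  have hlim : ∀ p : ℝ × Vec m, (p.1 : ℂ) ∈ D → Summable (fun n => seriesTerm Rp κ α β n p) →
      invIntertwine Rp κ f p = ∑' n, seriesTerm Rp κ α β n p := by
    intro p hp hs
    refine Filter.Tendsto.limUnder_eq ?_
    simpa only [expPartial, hterm _ p hp] using hs.hasSum.tendsto_sum_nat
  -- The neighbourhood consists of the points near which the terms have a uniform geometric
  -- majorant; asking this eventually around `p` makes it open at once.
  refine ⟨⟨{p | ∃ M, ∀ᶠ q in 𝓝 p, (q.1 : ℂ) ∈ D ∧
    ∀ n, ‖seriesTerm Rp κ α β n q‖ ≤ M * (1 / 2) ^ n}, ?_, ?_, ?_, ?_, ?_⟩, ?_⟩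
  · rw [isOpen_iff_eventually]
    rintro p ⟨M, hM⟩
    exact (Filter.Eventually.eventually_nhds hM).mono fun q hq => ⟨M, hq⟩
  · rintro p ⟨M, hM⟩
    exact hM.self_of_nhds.1
  · intro a ha
    exact hst.eventually_norm_seriesTerm_le_real hD ha
  · rintro p ⟨M, hM⟩
    obtain ⟨hpD, hp⟩ := hM.self_of_nhds
    simp only [hterm _ p hpD]
    exact Summable.of_nonneg_of_le (fun _ => norm_nonneg _) hp (summable_geometric_two.mul_left M)
  · rintro u hu p ⟨M, hM⟩
    refine ⟨_, mem_nhdsWithin_of_mem_nhds hM, ?_⟩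
    have h1 := tendstoUniformlyOn_tsum_nat (f := fun n p => seriesTerm Rp κ α β n p)
      (s := {q | (q.1 : ℂ) ∈ D ∧ ∀ n, ‖seriesTerm Rp κ α β n q‖ ≤ M * (1 / 2) ^ n})
      (summable_geometric_two.mul_left M) fun n q hq => hq.2 n
    filter_upwards [h1 u hu] with N hN q hq
    rw [hlim q hq.1 (Summable.of_norm_bounded (summable_geometric_two.mul_left M) hq.2)]
    simpa only [expPartial, hterm _ q hq.1] using hN q hq
  · intro U hU hUD hconv
    have hbd : ∀ p ∈ U, ∃ N, ∀ᶠ q in 𝓝 p, ∀ n, N ≤ n → ‖seriesTerm Rp κ α β n q‖ ≤ 1 := by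
      intro p hp
      -- A term is the difference of two consecutive partial sums, each within `1/2` of the limit.
      obtain ⟨t, ht, hN⟩ := Metric.tendstoLocallyUniformlyOn_iff.1 hconv (1 / 2) (by norm_num) p hp
      obtain ⟨N, hN⟩ := Filter.eventually_atTop.1 hN
      rw [hU.nhdsWithin_eq hp] at ht
      refine ⟨N, ?_⟩
      filter_upwards [ht, hU.mem_nhds hp] with q hq hqU n hn
      have h1 : seriesTerm Rp κ α β n q = expPartial Rp κ f (n + 1) q - expPartial Rp κ f n q := by
        rw [expPartial, expPartial, Finset.sum_range_succ, add_sub_cancel_left,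
          hterm n q (hUD q hqU)]
      rw [h1, ← dist_eq_norm]
      have h2 := hN n hn q hq
      have h3 := hN (n + 1) (by omega) q hq
      have h4 := dist_triangle_left (expPartial Rp κ f (n + 1) q) (expPartial Rp κ f n q)
        (invIntertwine Rp κ f q)
      linarith
    have hloc : ∀ p ∈ U, ∃ s ∈ 𝓝 p, ∃ G : ℝ × Vec m → ℝ × Vec m →L[ℝ] Cl m, ContinuousOn G s ∧
        ∀ q ∈ s, HasFDerivAt (invIntertwine Rp κ f) (G q) q ∧ cauchyRiemannL m (G q) = 0 := by
      intro p hp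
      obtain ⟨τ, hτ0, hτ1, N, hN⟩ := eventually_norm_seriesTerm_le hU hbd hp
      have hND : ∀ᶠ q in 𝓝 p, (q.1 : ℂ) ∈ D ∧
          ∀ n, N ≤ n → ‖seriesTerm Rp κ α β n q‖ ≤ τ ^ n := by
        filter_upwards [hU.mem_nhds hp, hN] with q hq hq'
        exact ⟨hUD q hq, hq'⟩
      obtain ⟨s, hs, G, hG, hGs⟩ :=
        exists_hasFDerivAt_tsum_seriesTerm hR hRp hκ hγ hD hst hτ0 hτ1 hND
      have heq : ∀ᶠ q in 𝓝 p, invIntertwine Rp κ f q = ∑' n, seriesTerm Rp κ α β n q := by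
        filter_upwards [hND] with q hq
        refine hlim q hq.1 ((summable_nat_add_iff N).1 (Summable.of_norm_bounded
          ((summable_nat_add_iff N).2 (summable_geometric_of_lt_one hτ0.le hτ1)) fun n => ?_))
        exact hq.2 _ (by omega)
      -- Transferring the derivative at `q` requires the two sums to agree on a neighbourhood of
      -- `q`, not just at `q`.
      refine ⟨s ∩ {q | ∀ᶠ q' in 𝓝 q, invIntertwine Rp κ f q' = ∑' n, seriesTerm Rp κ α β n q'},
        Filter.inter_mem hs heq.eventually_nhds, G, hG.mono Set.inter_subset_left, ?_⟩
      rintro q ⟨hq, hq'⟩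
      exact ⟨(hGs q hq).1.congr_of_eventuallyEq hq', (hGs q hq).2⟩
    refine ⟨?_, ?_⟩
    · intro p hp
      obtain ⟨s, hs, G, hG, hGs⟩ := hloc p hp
      refine ContDiffAt.contDiffWithinAt ?_
      rw [contDiffAt_one_iff]
      exact ⟨G, s, hs, hG, fun q hq => (hGs q hq).1⟩
    · intro p hp
      obtain ⟨s, hs, G, hG, hGs⟩ := hloc p hp
      obtain ⟨h1, h2⟩ := hGs p (mem_of_mem_nhds hs)
      rw [cauchyRiemann, h1.fderiv, ← cauchyRiemannL_apply, h2]
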